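/- **Setting.** Fix a first-order signature $\Sigma = CS\cup FS$ of constructor symbols and function symbols (disjoint, with arities) and a denumerable set $\mathcal V$ of variables. $Exp$ is the set of expressions $e ::= X \mid h(e_1,\dots,e_n)$ with $X\in\mathcal V$ and $h\in\Sigma$ of arity $n$; $CTerm\subseteq Exp$ is the set of expressions built from variables and constructors only; $LExp\supseteq Exp$ is the set of let-expressions, obtained by adding $let\ X=e_1\ in\ e_2$ (non-recursive: $X$ is bound in $e_2$ only), taken up to renaming of bound variables. Adding a fresh constant constructor $\perp$ gives $Exp_\perp, CTerm_\perp, LExp_\perp$. $\sqsubseteq$ is the least partial order with $\perp\sqsubseteq e$ that is closed under contexts. Substitutions have finite domain; $Subst$, $CSubst$, $CSubst_\perp$ are those with values in $Exp$, $CTerm$, $CTerm_\perp$. A program $\mathcal P$ is any set of rules $f(p_1,\dots,p_n)\to r$ with $f\in FS$, $(p_1,\dots,p_n)$ a tuple of c-terms in which no variable occurs twice, and $r\in Exp$ (extra variables in $r$ are allowed). * *Term rewriting* on $Exp$: $C[l\sigma]\to C[r\sigma]$ for a one-hole context $C$, $(l\to r)\in\mathcal P$, $\sigma\in Subst$; $\to^*$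 is its reflexive-transitive closure. * *Let-rewriting* on $LExp$: $\to_l$ is given by the following rules, applied inside any one-hole context $C$: (Fapp) $f(p_1,\dots,p_n)\theta\to_l r\theta$ for $(f(p_1,\dots,p_n)\to r)\in\mathcal P$, $\theta\in CSubst$, where for every variable $X$ not occurring in $p_1,\dots,p_n$ the term $\theta(X)$ contains no variable bound by $C$ at the hole; (LetIn) $h(\dots,e,\dots)\to_l let\ X=e\ in\ h(\dots,X,\dots)$ for $h\in\Sigma$, $X$ fresh, and $e$ of the form $f(\overline{e'})$ with $f\in FS$ or a let; (Bind) $let\ X=t\ in\ e\to_l e[X/t]$ for $t\in CTerm$; (Elim) $let\ X=e_1\ in\ e_2\to_l e_2$ if $X$ is not free in $e_2$; (Flat) $let\ X=(let\ Y=e_1\ in\ e_2)\ in\ e_3\to_l let\ Y=e_1\ in\ (let\ X=e_2\ in\ e_3)$ if $Y$ is not free in $e_3$. $\to_l^*$ is its reflexive-transitive closure. * *CRWL*: $\mathcal P\vdash e \rightarrowtriangle t$ ($e\in Exp_\perp$, $t\in CTerm_\perp$) is the least relation with: $e\rightarrowtriangle\perp$; $X\rightarrowtriangle X$; $c(e_1,\dots,e_n)\rightarrowtriangle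 c(t_1,\dots,t_n)$ for $c\in CS$ if all $e_i\rightarrowtriangle t_i$; $f(e_1,\dots,e_n)\rightarrowtriangle t$ if $(f(p_1,\dots,p_n)\to r)\in\mathcal P$, $\theta\in CSubst_\perp$, all $e_i\rightarrowtriangle p_i\theta$, and $r\theta\rightarrowtriangle t$. The denotation of $e$ is $[\![e]\!]=\{t\in CTerm_\perp \mid \mathcal P\vdash e\rightarrowtriangle t\}$. * The *shell* $|e|$ is given by $|X|=X$, $|c(e_1,\dots,e_n)|=c(|e_1|,\dots,|e_n|)$ for $c\in CS$, $|f(\dots)|=\perp$ for $f\in FS$, $|let\ X=e_1\ in\ e_2|=|e_2|[X/|e_1|]$. * $\mathcal P$ is *CRWL-deterministic* if for every $e\in Exp_\perp$ and all $t_1,t_2\in[\![e]\!]$ there is $t_3\in[\![e]\!]$ with $t_1\sqsubseteq t_3$ and $t_2\sqsubseteq t_3$. **Theorem.** Let $\mathcal P$ be a CRWL-deterministic program, $e,e'\in Exp$ and $t\in CTerm$. Then: a) $e\to^* e'$ implies $e\to_l^* e''$ for some $e''\in LExp$ with $|e'|\sqsubseteq |e''|$. b) $e\to^* t$ iff $e\to_l^*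 t$ iff $\mathcal P\vdash e\rightarrowtriangle t$. c) $e\to^* e'$ implies $[\![e']\!]\subseteq[\![e]\!]$. -/

import Mathlib

/-! # CRWL, term rewriting and let-rewriting

Let-expressions are represented up to renaming of bound variables: free variables are names taken
from a type `V`, and variables bound by a `let` are de Bruijn indices (index `0` refers to the
innermost enclosing `let`). All syntactic classes (expressions, let-expressions, c-terms and their
partial versions) are subsets of one type. -/

/-- A first order signature: constructor symbols and function symbols (disjoint), with arities. -/
structure Signature where
  CS : Type*
  FS : Type*
  arC : CS → ℕ
  arF : FS → ℕ

/-- Partial let-expressions (`LExp_⊥`) with free variables in `V`, under `n` enclosing `let`s whose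
bound variables are `bvar 0, …, bvar (n-1)`. In `letIn a b`, the definiens `a` does not see the
new bound variable (lets are not recursive); in the body `b` the new variable is `bvar 0`. -/
inductive LExp (S : Signature) (V : Type*) : ℕ → Type _
  | fvar {n : ℕ} (x : V) : LExp S V n
  | bvar {n : ℕ} (i : Fin n) : LExp S V n
  | bot {n : ℕ} : LExp S V n
  | con {n : ℕ} (c : S.CS) (es : Fin (S.arC c) → LExp S V n) : LExp S V n
  | fn {n : ℕ} (f : S.FS) (es : Fin (S.arF f) → LExp S V n) : LExp S V n
  | letIn {n : ℕ} (a : LExp S V n) (b : LExp S V (n + 1)) : LExp S V n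

namespace LExp

/-- `⊥` does not occur. -/
def NoBot {S : Signature} {V : Type*} : {n : ℕ} → LExp S V n → Prop
  | _, fvar _ => True
  | _, bvar _ => True
  | _, bot => False
  | _, con _ es => ∀ i, NoBot (es i)
  | _, fn _ es => ∀ i, NoBot (es i)
  | _, letIn a b => NoBot a ∧ NoBot b

/-- No `let` occurs. -/
def NoLet {S : Signature} {V : Type*} : {n : ℕ} → LExp S V n → Prop
  | _, fvar _ => True
  | _, bvar _ => True
  | _, bot => True
  | _, con _ es => ∀ i, NoLet (es i)
  | _, fn _ es => ∀ i, NoLet (es i)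
  | _, letIn _ _ => False

/-- No function symbol occurs. -/
def NoFun {S : Signature} {V : Type*} : {n : ℕ} → LExp S V n → Prop
  | _, fvar _ => True
  | _, bvar _ => True
  | _, bot => True
  | _, con _ es => ∀ i, NoFun (es i)
  | _, fn _ _ => False
  | _, letIn a b => NoFun a ∧ NoFun b

/-- No let-bound variable of an enclosing `let` occurs (used for c-terms only). -/
def NoBVar {S : Signature} {V : Type*} : {n : ℕ} → LExp S V n → Prop
  | _, fvar _ => True
  | _, bvar _ => False
  | _, bot => True
  | _, con _ es => ∀ i, NoBVar (es i)
  | _, fn _ es => ∀ i, NoBVar (es i)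
  | _, letIn _ _ => False

/-- `e ∈ LExp`. -/
def IsLExp {S : Signature} {V : Type*} {n : ℕ} (e : LExp S V n) : Prop := e.NoBot

/-- `e ∈ Exp_⊥`. -/
def IsPExp {S : Signature} {V : Type*} {n : ℕ} (e : LExp S V n) : Prop := e.NoLet

/-- `e ∈ Exp`. -/
def IsExp {S : Signature} {V : Type*} {n : ℕ} (e : LExp S V n) : Prop := e.NoLet ∧ e.NoBot

/-- `e ∈ CTerm_⊥`. -/
def IsPCTerm {S : Signature} {V : Type*} {n : ℕ} (e : LExp S V n) : Prop := e.NoLet ∧ e.NoFun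

/-- `e ∈ CTerm`. -/
def IsCTerm {S : Signature} {V : Type*} {n : ℕ} (e : LExp S V n) : Prop :=
  e.NoLet ∧ e.NoFun ∧ e.NoBot

/-- The expression is `f(…)` with `f` a function symbol, or is a `let`. -/
def IsFnOrLet {S : Signature} {V : Type*} {n : ℕ} : LExp S V n → Prop
  | fn _ _ => True
  | letIn _ _ => True
  | _ => False

open Classical in
/-- The number of occurrences of the free variable `x`. -/
noncomputable def occ {S : Signature} {V : Type*} (x : V) : {n : ℕ} → LExp S V n → ℕ
  | _, fvar y => if y = x then 1 else 0
  | _, bvar _ => 0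
  | _, bot => 0
  | _, con _ es => ∑ i, occ x (es i)
  | _, fn _ es => ∑ i, occ x (es i)
  | _, letIn a b => occ x a + occ x b

/-- Renaming of the let-bound variables of the enclosing `let`s. -/
def rename {S : Signature} {V : Type*} :
    {n m : ℕ} → (Fin n → Fin m) → LExp S V n → LExp S V m
  | _, _, _, fvar x => fvar x
  | _, _, ρ, bvar i => bvar (ρ i)
  | _, _, _, bot => bot
  | _, _, ρ, con c es => con c (fun i => rename ρ (es i))
  | _, _, ρ, fn f es => fn f (fun i => rename ρ (es i))
  | _, _, ρ, letIn a b =>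
      letIn (rename ρ a) (rename (Fin.cons 0 (fun i => (ρ i).succ)) b)

/-- The same expression placed under one more `let`, whose bound variable does not occur in it. -/
def weaken {S : Signature} {V : Type*} {n : ℕ} (e : LExp S V n) : LExp S V (n + 1) :=
  e.rename Fin.succ

/-- Capture-avoiding simultaneous substitution of the free variables (by `σ`) and of the variables
bound by enclosing `let`s (by `τ`). -/
def subst {S : Signature} {V : Type*} :
    {n m : ℕ} → (V → LExp S V m) → (Fin n → LExp S V m) → LExp S V n → LExp S V m
  | _, _, σ, _, fvar x => σ x
  | _, _, _, τ, bvar i => τ i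
  | _, _, _, _, bot => bot
  | _, _, σ, τ, con c es => con c (fun i => subst σ τ (es i))
  | _, _, σ, τ, fn f es => fn f (fun i => subst σ τ (es i))
  | _, _, σ, τ, letIn a b =>
      letIn (subst σ τ a)
        (subst (fun x => (σ x).weaken) (Fin.cons (bvar 0) (fun i => (τ i).weaken)) b)

/-- `e σ`, for `e` not under any `let`. -/
def app {S : Signature} {V : Type*} {m : ℕ} (e : LExp S V 0) (σ : V → LExp S V m) : LExp S V m :=
  e.subst σ Fin.elim0

/-- `b[X/a]`, where `X` is the variable bound by the innermost enclosing `let`. -/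
def inst {S : Signature} {V : Type*} {n : ℕ} (b : LExp S V (n + 1)) (a : LExp S V n) :
    LExp S V n :=
  b.subst fvar (Fin.cons a bvar)

/-- The shell `|e|` of a let-expression: its outer constructor part. -/
def shell {S : Signature} {V : Type*} : {n : ℕ} → LExp S V n → LExp S V n
  | _, fvar x => fvar x
  | _, bvar i => bvar i
  | _, bot => bot
  | _, con c es => con c (fun i => shell (es i))
  | _, fn _ _ => bot
  | _, letIn a b => (shell b).inst (shell a)

/-- The approximation ordering `⊑`: the least partial ordering with `⊥ ⊑ e` that is closed under
contexts (here given by its congruence rules). -/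
inductive Approx {S : Signature} {V : Type*} : {n : ℕ} → LExp S V n → LExp S V n → Prop
  | bot {n : ℕ} (e : LExp S V n) : Approx LExp.bot e
  | fvar {n : ℕ} (x : V) : Approx (LExp.fvar x : LExp S V n) (LExp.fvar x)
  | bvar {n : ℕ} (i : Fin n) : Approx (LExp.bvar i : LExp S V n) (LExp.bvar i)
  | con {n : ℕ} (c : S.CS) (es es' : Fin (S.arC c) → LExp S V n)
      (h : ∀ i, Approx (es i) (es' i)) : Approx (LExp.con c es) (LExp.con c es')
  | fn {n : ℕ} (f : S.FS) (es es' : Fin (S.arF f) → LExp S V n)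
      (h : ∀ i, Approx (es i) (es' i)) : Approx (LExp.fn f es) (LExp.fn f es')
  | letIn {n : ℕ} (a a' : LExp S V n) (b b' : LExp S V (n + 1))
      (ha : Approx a a') (hb : Approx b b') : Approx (LExp.letIn a b) (LExp.letIn a' b')

end LExp

/-- One-hole contexts. The context itself is under `n` enclosing `let`s and its hole is under `m`
enclosing `let`s, so the variables bound by a context `Ctx S V m 0` are `bvar 0, …, bvar (m-1)` at
the hole. In `con c i es C` and `fn f i es C` the hole is in the `i`-th argument (`es i` itself is
irrelevant). -/
inductive Ctx (S : Signature) (V : Type*) (m : ℕ) : ℕ → Type _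
  | hole : Ctx S V m m
  | con {n : ℕ} (c : S.CS) (i : Fin (S.arC c)) (es : Fin (S.arC c) → LExp S V n)
      (C : Ctx S V m n) : Ctx S V m n
  | fn {n : ℕ} (f : S.FS) (i : Fin (S.arF f)) (es : Fin (S.arF f) → LExp S V n)
      (C : Ctx S V m n) : Ctx S V m n
  | letDef {n : ℕ} (C : Ctx S V m n) (b : LExp S V (n + 1)) : Ctx S V m n
  | letBody {n : ℕ} (a : LExp S V n) (C : Ctx S V m (n + 1)) : Ctx S V m n

/-- `C[e]`. -/
def Ctx.plug {S : Signature} {V : Type*} {m : ℕ} :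
    {n : ℕ} → Ctx S V m n → LExp S V m → LExp S V n
  | _, .hole, e => e
  | _, .con c i es C, e => .con c (Function.update es i (C.plug e))
  | _, .fn f i es C, e => .fn f (Function.update es i (C.plug e))
  | _, .letDef C b, e => .letIn (C.plug e) b
  | _, .letBody a C, e => .letIn a (C.plug e)

/-- `σ` differs from the identity at finitely many variables only. -/
def FiniteDom {S : Signature} {V : Type*} {n : ℕ} (σ : V → LExp S V n) : Prop :=
  {x : V | σ x ≠ LExp.fvar x}.Finite

/-- `σ ∈ Subst`. -/
def IsSubst {S : Signature} {V : Type*} {n : ℕ} (σ : V → LExp S V n) : Prop :=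
  FiniteDom σ ∧ ∀ x, (σ x).IsExp

/-- `σ ∈ CSubst`. -/
def IsCSubst {S : Signature} {V : Type*} {n : ℕ} (σ : V → LExp S V n) : Prop :=
  FiniteDom σ ∧ ∀ x, (σ x).IsCTerm

/-- `σ ∈ CSubst_⊥`. -/
def IsPCSubst {S : Signature} {V : Type*} {n : ℕ} (σ : V → LExp S V n) : Prop :=
  FiniteDom σ ∧ ∀ x, (σ x).IsPCTerm

/-- A rule `f(p₁, …, pₙ) → r`. -/
structure Rule (S : Signature) (V : Type*) where
  f : S.FS
  pats : Fin (S.arF f) → LExp S V 0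
  rhs : LExp S V 0

/-- Program rules without lets: the arguments of the left-hand side form a linear tuple of (total)
c-terms, and the right-hand side is an expression of `Exp` (extra variables are allowed). -/
def Rule.IsProgramRule {S : Signature} {V : Type*} (R : Rule S V) : Prop :=
  (∀ i, (R.pats i).IsCTerm) ∧ (∀ x : V, ∑ i, (R.pats i).occ x ≤ 1) ∧ R.rhs.IsExp

/-- A program (without lets): any set of program rules. -/
structure Program (S : Signature) (V : Type*) where
  rules : Set (Rule S V)
  isProgramRule : ∀ R ∈ rules, R.IsProgramRule

/-- One step `C[lσ] → C[rσ]` of term rewriting, on expressions of `Exp`. -/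
def RwStep {S : Signature} {V : Type*} (P : Program S V) (e e' : LExp S V 0) : Prop :=
  e.IsExp ∧ ∃ (C : Ctx S V 0 0) (R : Rule S V) (σ : V → LExp S V 0),
    R ∈ P.rules ∧ IsSubst σ ∧
    e = C.plug (.fn R.f (fun i => (R.pats i).app σ)) ∧ e' = C.plug (R.rhs.app σ)

/-- `e →* e'` by term rewriting. -/
def RwSteps {S : Signature} {V : Type*} (P : Program S V) (e e' : LExp S V 0) : Prop :=
  Relation.ReflTransGen (RwStep P) e e'

/-- The rules of let-rewriting other than (Contx), for a redex under `n` enclosing `let`s. In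
`fapp`, the last hypothesis says that extra variables are not instantiated by terms containing
variables bound by the surrounding context; it is void for `n = 0`. -/
inductive LetRedex {S : Signature} {V : Type*} (P : Program S V) :
    {n : ℕ} → LExp S V n → LExp S V n → Prop
  | fapp {n : ℕ} (f : S.FS) (ps : Fin (S.arF f) → LExp S V 0) (r : LExp S V 0)
      (θ : V → LExp S V n) (hR : (⟨f, ps, r⟩ : Rule S V) ∈ P.rules) (hθ : IsCSubst θ)
      (hextra : ∀ x : V, (∀ i, (ps i).occ x = 0) → (θ x).NoBVar) :
      LetRedex P (.fn f (fun i => (ps i).app θ)) (r.app θ)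
  | letInCon {n : ℕ} (c : S.CS) (es : Fin (S.arC c) → LExp S V n) (i : Fin (S.arC c))
      (h : (es i).IsFnOrLet) :
      LetRedex P (.con c es)
        (.letIn (es i) (.con c (Function.update (fun j => (es j).weaken) i (.bvar 0))))
  | letInFn {n : ℕ} (f : S.FS) (es : Fin (S.arF f) → LExp S V n) (i : Fin (S.arF f))
      (h : (es i).IsFnOrLet) :
      LetRedex P (.fn f es)
        (.letIn (es i) (.fn f (Function.update (fun j => (es j).weaken) i (.bvar 0))))
  | bind {n : ℕ} (t : LExp S V n) (b : LExp S V (n + 1)) (ht : t.IsCTerm) :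
      LetRedex P (.letIn t b) (b.inst t)
  | elim {n : ℕ} (a b : LExp S V n) :
      LetRedex P (.letIn a b.weaken) b
  | flat {n : ℕ} (e₁ : LExp S V n) (e₂ e₃ : LExp S V (n + 1)) :
      LetRedex P (.letIn (.letIn e₁ e₂) e₃)
        (.letIn e₁ (.letIn e₂ (e₃.rename (Fin.cons 0 (fun i => i.succ.succ)))))

/-- One let-rewriting step: a rule applied inside a context. -/
def LetStep {S : Signature} {V : Type*} (P : Program S V) {n : ℕ} (e e' : LExp S V n) : Prop :=
  ∃ (m : ℕ) (C : Ctx S V m n) (a a' : LExp S V m),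
    LetRedex P a a' ∧ e = C.plug a ∧ e' = C.plug a'

/-- Let-rewriting derivations. -/
def LetSteps {S : Signature} {V : Type*} (P : Program S V) {n : ℕ} (e e' : LExp S V n) : Prop :=
  Relation.ReflTransGen (LetStep P) e e'

/-- The CRWL-calculus: `CRWL P e t` says that the statement "`e` reduces to the value `t`" is
derivable from the program `P`, for `e ∈ Exp_⊥` and `t ∈ CTerm_⊥`. -/
inductive CRWL {S : Signature} {V : Type*} (P : Program S V) : LExp S V 0 → LExp S V 0 → Prop
  | B (e : LExp S V 0) : CRWL P e .bot
  | RR (x : V) : CRWL P (.fvar x) (.fvar x)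
  | DC (c : S.CS) (es ts : Fin (S.arC c) → LExp S V 0) (h : ∀ i, CRWL P (es i) (ts i)) :
      CRWL P (.con c es) (.con c ts)
  | OR (f : S.FS) (ps : Fin (S.arF f) → LExp S V 0) (r : LExp S V 0) (θ : V → LExp S V 0)
      (es : Fin (S.arF f) → LExp S V 0) (t : LExp S V 0)
      (hR : (⟨f, ps, r⟩ : Rule S V) ∈ P.rules) (hθ : IsPCSubst θ)
      (hargs : ∀ i, CRWL P (es i) ((ps i).app θ)) (hr : CRWL P (r.app θ) t) :
      CRWL P (.fn f es) t

/-- The CRWL-denotation of an expression. -/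
def den {S : Signature} {V : Type*} (P : Program S V) (e : LExp S V 0) : Set (LExp S V 0) :=
  {t | t.IsPCTerm ∧ CRWL P e t}

/-- CRWL-deterministic programs: the denotation of every partial expression is directed. -/
def Program.IsCRWLDeterministic {S : Signature} {V : Type*} (P : Program S V) : Prop :=
  ∀ e : LExp S V 0, e.IsPExp → DirectedOn LExp.Approx (den P e)

/-! CRWL is the pivot: both kinds of rewriting are compared with it, and determinism enters only in
passing from term rewriting to CRWL.

From term rewriting to CRWL: a redex `lσ` may copy unevaluated expressions `σ(X)`, whose copies in
`rσ` can evaluate to different values, while CRWL evaluates each `σ(X)` once. For a deterministic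
program these finitely many values have a common upper bound in the denotation of `σ(X)`, so a value
of `rσ` is already a value of `rθ` for one partial c-substitution `θ` with `σ(X)` evaluating to
`θ(X)` (`CRWL.exists_pcSubst`). Hence a step never creates values (`CRWL.of_rwSteps`).

From CRWL back to rewriting: a derivation is replayed on expressions lying above the partial ones it
mentions. Patterns are linear and total, so whatever lies above an instance of a pattern is an
instance itself (`exists_match_rule`). Term rewriting evaluates arguments in place
(`CRWL.exists_preRwSteps`); let-rewriting leaves unneeded calls in a telescope of lets around the
result (`CRWL.reach`).

From let-rewriting to CRWL: in the environment semantics `LetDen` a let fixes one value of its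
definiens, and no rule creates values (`LetRedex.letDen`).

The statement on shells follows because `|e'|` is a value of `e'`, hence of `e`, and a telescope
whose body lies above a value has its shell above it. -/

namespace LExp

/-! ### Substitution, approximation and matching -/

section Basic

variable {S : Signature} {V : Type*}

/-- Induction over the let-free expressions that are not under any `let`. -/
theorem noLet_induction {motive : (e : LExp S V 0) → e.NoLet → Prop}
    (fvar : ∀ x, motive (.fvar x) trivial) (bot : motive .bot trivial)
    (con : ∀ c (es : Fin (S.arC c) → LExp S V 0) (h : NoLet (.con c es)), (∀ i, motive (es i) (h i)) → motive (.con c es) h)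
    (fn : ∀ f (es : Fin (S.arF f) → LExp S V 0) (h : NoLet (.fn f es)), (∀ i, motive (es i) (h i)) → motive (.fn f es) h)
    (e : LExp S V 0) (he : e.NoLet) : motive e he := by
  have key : ∀ (n : ℕ) (e : LExp S V n) (h0 : n = 0) (he : e.NoLet),
      motive (h0 ▸ e) (by subst h0; exact he) := by
    intro n e
    induction e with
    | fvar x => rintro rfl _; exact fvar x
    | bvar i => rintro rfl _; exact i.elim0
    | bot => rintro rfl _; exact bot
    | con c es ih => rintro rfl he; exact con c es he fun i => ih i rfl (he i)
    | fn f es ih => rintro rfl he; exact fn f es he fun i => ih i rfl (he i)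
    | letIn a b => intro _ he; exact he.elim
  exact key 0 e rfl he

@[simp] theorem app_fvar {m : ℕ} (σ : V → LExp S V m) (x : V) :
    (LExp.fvar x : LExp S V 0).app σ = σ x := rfl

@[simp] theorem app_bot {m : ℕ} (σ : V → LExp S V m) : (LExp.bot : LExp S V 0).app σ = .bot := rfl

@[simp] theorem app_con {m : ℕ} (σ : V → LExp S V m) (c : S.CS)
    (es : Fin (S.arC c) → LExp S V 0) :
    (LExp.con c es).app σ = .con c (fun i => (es i).app σ) := rfl

@[simp] theorem app_fn {m : ℕ} (σ : V → LExp S V m) (f : S.FS)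
    (es : Fin (S.arF f) → LExp S V 0) :
    (LExp.fn f es).app σ = .fn f (fun i => (es i).app σ) := rfl

theorem IsCTerm.isExp {n : ℕ} {e : LExp S V n} (h : e.IsCTerm) : e.IsExp := ⟨h.1, h.2.2⟩

theorem IsCTerm.isPCTerm {n : ℕ} {e : LExp S V n} (h : e.IsCTerm) : e.IsPCTerm := ⟨h.1, h.2.1⟩

theorem isExp_con {n : ℕ} {c : S.CS} {es : Fin (S.arC c) → LExp S V n} :
    (LExp.con c es).IsExp ↔ ∀ i, (es i).IsExp :=
  ⟨fun h i => ⟨h.1 i, h.2 i⟩, fun h => ⟨fun i => (h i).1, fun i => (h i).2⟩⟩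

theorem isExp_fn {n : ℕ} {f : S.FS} {es : Fin (S.arF f) → LExp S V n} :
    (LExp.fn f es).IsExp ↔ ∀ i, (es i).IsExp :=
  ⟨fun h i => ⟨h.1 i, h.2 i⟩, fun h => ⟨fun i => (h i).1, fun i => (h i).2⟩⟩

theorem isCTerm_con {n : ℕ} {c : S.CS} {es : Fin (S.arC c) → LExp S V n} :
    (LExp.con c es).IsCTerm ↔ ∀ i, (es i).IsCTerm :=
  ⟨fun h i => ⟨h.1 i, h.2.1 i, h.2.2 i⟩,
    fun h => ⟨fun i => (h i).1, fun i => (h i).2.1, fun i => (h i).2.2⟩⟩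

theorem isPCTerm_con {n : ℕ} {c : S.CS} {es : Fin (S.arC c) → LExp S V n} :
    (LExp.con c es).IsPCTerm ↔ ∀ i, (es i).IsPCTerm :=
  ⟨fun h i => ⟨h.1 i, h.2 i⟩, fun h => ⟨fun i => (h i).1, fun i => (h i).2⟩⟩

theorem isPCTerm_bot {n : ℕ} : (LExp.bot : LExp S V n).IsPCTerm := ⟨trivial, trivial⟩

theorem isPCTerm_fvar {n : ℕ} (x : V) : (LExp.fvar x : LExp S V n).IsPCTerm := ⟨trivial, trivial⟩

theorem isCTerm_fvar {n : ℕ} (x : V) : (LExp.fvar x : LExp S V n).IsCTerm :=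
  ⟨trivial, trivial, trivial⟩

theorem isCTerm_bvar {n : ℕ} (i : Fin n) : (LExp.bvar i : LExp S V n).IsCTerm :=
  ⟨trivial, trivial, trivial⟩

theorem NoLet.subst {n m : ℕ} {e : LExp S V n} (he : e.NoLet) {σ : V → LExp S V m}
    {τ : Fin n → LExp S V m} (hσ : ∀ x, (σ x).NoLet) (hτ : ∀ i, (τ i).NoLet) :
    (e.subst σ τ).NoLet := by
  induction e with
  | fvar x => exact hσ x
  | bvar i => exact hτ i
  | bot => trivial
  | con c es ih => exact fun i => ih i (he i) hτ
  | fn f es ih => exact fun i => ih i (he i) hτ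
  | letIn a b => exact he.elim

theorem NoFun.subst {n m : ℕ} {e : LExp S V n} (hl : e.NoLet) (he : e.NoFun)
    {σ : V → LExp S V m} {τ : Fin n → LExp S V m} (hσ : ∀ x, (σ x).NoFun)
    (hτ : ∀ i, (τ i).NoFun) : (e.subst σ τ).NoFun := by
  induction e with
  | fvar x => exact hσ x
  | bvar i => exact hτ i
  | bot => trivial
  | con c es ih => exact fun i => ih i (hl i) (he i) hτ
  | fn f es ih => exact he.elim
  | letIn a b => exact hl.elim

theorem noBot_rename {n m : ℕ} {e : LExp S V n} {ρ : Fin n → Fin m} :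
    (e.rename ρ).NoBot ↔ e.NoBot := by
  induction e generalizing m with
  | fvar x => rfl
  | bvar i => rfl
  | bot => rfl
  | con c es ih => exact forall_congr' fun i => ih i
  | fn f es ih => exact forall_congr' fun i => ih i
  | letIn a b iha ihb => exact and_congr iha ihb

theorem NoBot.subst {n m : ℕ} {e : LExp S V n} (he : e.NoBot) {σ : V → LExp S V m}
    {τ : Fin n → LExp S V m} (hσ : ∀ x, (σ x).NoBot) (hτ : ∀ i, (τ i).NoBot) :
    (e.subst σ τ).NoBot := by
  induction e generalizing m with
  | fvar x => exact hσ x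
  | bvar i => exact hτ i
  | bot => exact he.elim
  | con c es ih => exact fun i => ih i (he i) hσ hτ
  | fn f es ih => exact fun i => ih i (he i) hσ hτ
  | letIn a b iha ihb =>
    refine ⟨iha he.1 hσ hτ, ihb he.2 (fun x => noBot_rename.2 (hσ x)) fun i => ?_⟩
    refine Fin.cases ?_ (fun j => ?_) i
    · trivial
    · exact noBot_rename.2 (hτ j)

theorem IsPCTerm.subst {n m : ℕ} {e : LExp S V n} (he : e.IsPCTerm) {σ : V → LExp S V m}
    {τ : Fin n → LExp S V m} (hσ : ∀ x, (σ x).IsPCTerm) (hτ : ∀ i, (τ i).IsPCTerm) :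
    (e.subst σ τ).IsPCTerm :=
  ⟨he.1.subst (fun x => (hσ x).1) fun i => (hτ i).1,
    NoFun.subst he.1 he.2 (fun x => (hσ x).2) fun i => (hτ i).2⟩

theorem IsCTerm.subst {n m : ℕ} {e : LExp S V n} (he : e.IsCTerm) {σ : V → LExp S V m}
    {τ : Fin n → LExp S V m} (hσ : ∀ x, (σ x).IsCTerm) (hτ : ∀ i, (τ i).IsCTerm) :
    (e.subst σ τ).IsCTerm :=
  ⟨he.1.subst (fun x => (hσ x).1) fun i => (hτ i).1,
    NoFun.subst he.1 he.2.1 (fun x => (hσ x).2.1) fun i => (hτ i).2.1,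
    he.2.2.subst (fun x => (hσ x).2.2) fun i => (hτ i).2.2⟩

theorem IsExp.app {m : ℕ} {e : LExp S V 0} (he : e.IsExp) {σ : V → LExp S V m}
    (hσ : ∀ x, (σ x).IsExp) : (e.app σ).IsExp :=
  ⟨he.1.subst (fun x => (hσ x).1) fun i => i.elim0,
    he.2.subst (fun x => (hσ x).2) fun i => i.elim0⟩

theorem rename_eq_subst {n m : ℕ} (e : LExp S V n) (ρ : Fin n → Fin m) :
    e.rename ρ = e.subst fvar (fun i => bvar (ρ i)) := by
  induction e generalizing m with
  | fvar x => rfl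
  | bvar i => rfl
  | bot => rfl
  | con c es ih => exact congrArg _ (funext fun i => ih i ρ)
  | fn f es ih => exact congrArg _ (funext fun i => ih i ρ)
  | letIn a b iha ihb =>
    refine congrArg₂ _ (iha ρ) ((ihb _).trans ?_)
    refine congrArg (fun τ => b.subst fvar τ) (funext fun i => ?_)
    refine Fin.cases ?_ (fun j => ?_) i <;> rfl

/-- Without lets in `e` no binder is crossed, so composition needs no commutation of weakening with
substitution. -/
theorem NoLet.subst_subst {n m k : ℕ} {e : LExp S V n} (he : e.NoLet) (σ : V → LExp S V m)
    (τ : Fin n → LExp S V m) (σ' : V → LExp S V k) (τ' : Fin m → LExp S V k) :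
    (e.subst σ τ).subst σ' τ' =
      e.subst (fun x => (σ x).subst σ' τ') (fun i => (τ i).subst σ' τ') := by
  induction e with
  | fvar x => rfl
  | bvar i => rfl
  | bot => rfl
  | con c es ih => exact congrArg _ (funext fun i => ih i (he i) τ)
  | fn f es ih => exact congrArg _ (funext fun i => ih i (he i) τ)
  | letIn a b => exact he.elim

theorem IsCTerm.weaken {n : ℕ} {e : LExp S V n} (he : e.IsCTerm) : e.weaken.IsCTerm := by
  rw [LExp.weaken, rename_eq_subst]
  exact he.subst isCTerm_fvar fun i => isCTerm_bvar _

theorem NoLet.app_id {e : LExp S V 0} (he : e.NoLet) (τ : Fin 0 → LExp S V 0) :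
    e.subst fvar τ = e := by
  induction e, he using noLet_induction with
  | fvar x => rfl
  | bot => rfl
  | con c es h ih => exact congrArg _ (funext ih)
  | fn f es h ih => exact congrArg _ (funext ih)

theorem NoLet.app_congr {m : ℕ} {e : LExp S V 0} (he : e.NoLet) {σ σ' : V → LExp S V m}
    (h : ∀ x, e.occ x ≠ 0 → σ x = σ' x) : e.app σ = e.app σ' := by
  induction e, he using noLet_induction with
  | fvar x => exact h x (by simp [occ])
  | bot => rfl
  | con c es _ ih =>
    refine congrArg (LExp.con c) (funext fun i => ih i fun x hx => h x fun h0 => hx ?_)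
    exact Finset.sum_eq_zero_iff.1 h0 i (Finset.mem_univ i)
  | fn f es _ ih =>
    refine congrArg (LExp.fn f) (funext fun i => ih i fun x hx => h x fun h0 => hx ?_)
    exact Finset.sum_eq_zero_iff.1 h0 i (Finset.mem_univ i)

theorem finite_occ {n : ℕ} (e : LExp S V n) : {x : V | e.occ x ≠ 0}.Finite := by
  induction e with
  | fvar y =>
    refine (Set.finite_singleton y).subset fun x hx => ?_
    by_contra h
    exact hx (if_neg fun h' => h h'.symm)
  | bvar i => exact Set.finite_empty.subset fun x hx => hx rfl
  | bot => exact Set.finite_empty.subset fun x hx => hx rfl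
  | con c es ih =>
    refine (Set.finite_iUnion ih).subset fun x hx => ?_
    by_contra h
    simp only [Set.mem_iUnion, Set.mem_ofPred_eq, not_exists, not_not] at h
    exact hx (Finset.sum_eq_zero fun i _ => h i)
  | fn f es ih =>
    refine (Set.finite_iUnion ih).subset fun x hx => ?_
    by_contra h
    simp only [Set.mem_iUnion, Set.mem_ofPred_eq, not_exists, not_not] at h
    exact hx (Finset.sum_eq_zero fun i _ => h i)
  | letIn a b iha ihb =>
    refine (iha.union ihb).subset fun x hx => ?_
    by_contra h
    simp only [Set.mem_union, Set.mem_ofPred_eq, not_or, not_not] at h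
    exact hx (by simp [occ, h.1, h.2])

theorem Approx.trans {n : ℕ} {e₁ e₂ e₃ : LExp S V n} (h : Approx e₁ e₂) (h' : Approx e₂ e₃) :
    Approx e₁ e₃ := by
  induction h with
  | bot => exact .bot _
  | fvar => exact h'
  | bvar => exact h'
  | con c es es' _ ih => cases h' with | con _ _ es'' h'' => exact .con c _ _ fun i => ih i (h'' i)
  | fn c es es' _ ih => cases h' with | fn _ _ es'' h'' => exact .fn c _ _ fun i => ih i (h'' i)
  | letIn a a' b b' _ _ iha ihb =>
    cases h' with | letIn _ a'' _ b'' ha hb => exact .letIn _ _ _ _ (iha ha) (ihb hb)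

theorem NoLet.approx_app {e : LExp S V 0} (he : e.NoLet) {θ θ' : V → LExp S V 0}
    (h : ∀ x, Approx (θ x) (θ' x)) : Approx (e.app θ) (e.app θ') := by
  induction e, he using noLet_induction with
  | fvar x => exact h x
  | bot => exact .bot _
  | con c es _ ih => exact .con _ _ _ ih
  | fn f es _ ih => exact .fn _ _ _ ih

/-- `Below t e`: the let-free expression `t` approximates the let-free expression `e`, where `e`
may be under some `let`s. -/
inductive Below {n : ℕ} : LExp S V 0 → LExp S V n → Prop
  | bot (e : LExp S V n) : Below .bot e
  | fvar (x : V) : Below (.fvar x) (.fvar x)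
  | con (c : S.CS) (es : Fin (S.arC c) → LExp S V 0) (es' : Fin (S.arC c) → LExp S V n)
      (h : ∀ i, Below (es i) (es' i)) : Below (.con c es) (.con c es')
  | fn (f : S.FS) (es : Fin (S.arF f) → LExp S V 0) (es' : Fin (S.arF f) → LExp S V n)
      (h : ∀ i, Below (es i) (es' i)) : Below (.fn f es) (.fn f es')

theorem Below.approx {t e : LExp S V 0} (h : Below t e) : Approx t e := by
  induction h with
  | bot => exact .bot _
  | fvar => exact .fvar _
  | con c es es' _ ih => exact .con _ _ _ ih
  | fn c es es' _ ih => exact .fn _ _ _ ih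

theorem NoLet.below_refl {e : LExp S V 0} (he : e.NoLet) : Below e e := by
  induction e, he using noLet_induction with
  | fvar x => exact .fvar x
  | bot => exact .bot _
  | con c es _ ih => exact .con _ _ _ ih
  | fn f es _ ih => exact .fn _ _ _ ih

theorem NoLet.below_app {m : ℕ} {e : LExp S V 0} (he : e.NoLet) {θ : V → LExp S V 0}
    {σ : V → LExp S V m} (h : ∀ x, Below (θ x) (σ x)) : Below (e.app θ) (e.app σ) := by
  induction e, he using noLet_induction with
  | fvar x => exact h x
  | bot => exact .bot _
  | con c es _ ih => exact .con _ _ _ ih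
  | fn f es _ ih => exact .fn _ _ _ ih

/-- Let-bound variables of `e` can occur only where `t` has `⊥`, so replacing them is invisible to
`t`. -/
theorem Below.subst {n m : ℕ} {t : LExp S V 0} {e : LExp S V n} (h : Below t e)
    (τ : Fin n → LExp S V m) : Below t (e.subst LExp.fvar τ) := by
  induction h with
  | bot => exact .bot _
  | fvar => exact .fvar _
  | con c es es' _ ih => exact .con _ _ _ ih
  | fn c es es' _ ih => exact .fn _ _ _ ih

/-- A function call in `e` can lie only over a `⊥` of the c-term `t`, so erasing it does no harm. -/
theorem Below.shell {n : ℕ} {t : LExp S V 0} {e : LExp S V n} (h : Below t e)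
    (ht : t.IsPCTerm) : Below t e.shell := by
  induction h with
  | bot => exact .bot _
  | fvar => exact .fvar _
  | con c es es' _ ih => exact .con _ _ _ fun i => ih i (isPCTerm_con.1 ht i)
  | fn c es es' _ ih => exact ht.2.elim

/-- Puts a let-free expression under any number of `let`s, filling `⊥` by the variable `v`. -/
def fill (v : V) {n : ℕ} : {m : ℕ} → LExp S V m → LExp S V n
  | _, fvar x => fvar x
  | _, bvar _ => fvar v
  | _, bot => fvar v
  | _, con c es => con c (fun i => fill v (es i))
  | _, fn f es => fn f (fun i => fill v (es i))
  | _, letIn _ _ => fvar v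

theorem NoLet.below_fill {n : ℕ} (v : V) {e : LExp S V 0} (he : e.NoLet) :
    Below e (fill v e : LExp S V n) := by
  induction e, he using noLet_induction with
  | fvar x => exact .fvar x
  | bot => exact .bot _
  | con c es _ ih => exact .con _ _ _ ih
  | fn f es _ ih => exact .fn _ _ _ ih

theorem IsPCTerm.fill {n : ℕ} (v : V) {e : LExp S V 0} (he : e.IsPCTerm) :
    (fill v e : LExp S V n).IsCTerm ∧ (LExp.fill v e : LExp S V n).NoBVar := by
  obtain ⟨h1, h2⟩ := he
  induction e, h1 using noLet_induction with
  | fvar x => exact ⟨isCTerm_fvar x, trivial⟩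
  | bot => exact ⟨isCTerm_fvar v, trivial⟩
  | con c es _ ih => exact ⟨isCTerm_con.2 fun i => (ih i (h2 i)).1, fun i => (ih i (h2 i)).2⟩
  | fn f es _ ih => exact h2.elim

/-- There is no room above a total `t`: this turns approximation into equality for total values. -/
theorem Below.eq_fill {n : ℕ} (v : V) {t : LExp S V 0} {e : LExp S V n} (h : Below t e)
    (ht : t.NoBot) : e = fill v t := by
  induction h with
  | bot => exact ht.elim
  | fvar => rfl
  | con c es es' _ ih => exact congrArg _ (funext fun i => ih i (ht i))
  | fn c es es' _ ih => exact congrArg _ (funext fun i => ih i (ht i))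

theorem fill_self (v : V) {t : LExp S V 0} (ht : t.IsExp) : fill v t = t :=
  (ht.1.below_refl.eq_fill v ht.2).symm

theorem weaken_fill {n m : ℕ} (v : V) (t : LExp S V m) :
    (fill v t : LExp S V n).weaken = fill v t := by
  induction t with
  | con c es ih => exact congrArg _ (funext ih)
  | fn f es ih => exact congrArg _ (funext ih)
  | _ => rfl

/-! ### Matching linear patterns -/

/-- By linearity each variable belongs to at most one `ps i`, so separate matchers glue to one
substitution, with `d` as default on the remaining variables. -/
theorem exists_app_eq_app {ι : Type*} [Fintype ι] {n : ℕ} {ps : ι → LExp S V 0}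
    (hps : ∀ i, (ps i).NoLet) (hlin : ∀ x : V, ∑ i, (ps i).occ x ≤ 1) (A : V → LExp S V n → Prop)
    {d : V → LExp S V n} (hd : ∀ x, A x (d x)) (σs : ι → V → LExp S V n)
    (hσs : ∀ i x, A x (σs i x)) :
    ∃ σ : V → LExp S V n, (∀ i, (ps i).app (σs i) = (ps i).app σ) ∧ (∀ x, A x (σ x)) ∧
      ∀ x, (∀ i, (ps i).occ x = 0) → σ x = d x := by
  classical
  refine ⟨fun x => if h : ∃ i, (ps i).occ x ≠ 0 then σs h.choose x else d x, fun i => ?_,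
    fun x => ?_, fun x hx => dif_neg fun ⟨i, hi⟩ => hi (hx i)⟩
  · refine (hps i).app_congr fun x hx => ?_
    have h : ∃ i, (ps i).occ x ≠ 0 := ⟨i, hx⟩
    rw [dif_pos h]
    by_contra hne
    have hij : i ≠ h.choose := fun hij => hne (by rw [← hij])
    -- Two different patterns containing `x` would already give two occurrences.
    have h1 := Finset.sum_le_univ_sum_of_nonneg (s := {i, h.choose})
      (f := fun i => (ps i).occ x) (fun _ => Nat.zero_le _)
    rw [Finset.sum_pair hij] at h1
    have h2 := hlin x
    have h3 := h.choose_spec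
    omega
  · dsimp only
    split_ifs
    exacts [hσs _ x, hd x]

/-- A total pattern puts a constructor at each inner position, so anything above `p.app θ` has the
same constructors there, and linearity rules out clashes at the variables. `Q` is the class in which
the matcher takes its values. -/
theorem exists_match {n : ℕ} {Q : LExp S V n → Prop}
    (hQ : ∀ c (es : Fin (S.arC c) → LExp S V n), Q (.con c es) → ∀ i, Q (es i))
    {θ : V → LExp S V 0} {d : V → LExp S V n} (hd : ∀ x, Below (θ x) (d x) ∧ Q (d x))
    {p : LExp S V 0} (hp : p.IsCTerm) (hlin : ∀ x, p.occ x ≤ 1) {u : LExp S V n}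
    (hu : Q u) (h : Below (p.app θ) u) :
    ∃ σ : V → LExp S V n, u = p.app σ ∧ (∀ x, Below (θ x) (σ x) ∧ Q (σ x)) ∧
      ∀ x, p.occ x = 0 → σ x = d x := by
  classical
  obtain ⟨h1, h2, h3⟩ := hp
  induction p, h1 using noLet_induction generalizing u with
  | fvar y =>
    refine ⟨Function.update d y u, (Function.update_self y u d).symm, fun x => ?_, fun x hx => ?_⟩
    · by_cases hx : x = y
      · subst hx; simpa using ⟨h, hu⟩
      · simpa [hx] using hd x
    · have : x ≠ y := fun hxy => by simp [occ, hxy] at hx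
      simp [this]
  | bot => exact h3.elim
  | con c ps hps ih =>
    cases h with | con _ _ us hus =>
    have hlin' : ∀ i x, (ps i).occ x ≤ 1 := fun i x =>
      (Finset.single_le_sum (f := fun i => (ps i).occ x) (fun _ _ => Nat.zero_le _)
        (Finset.mem_univ i)).trans (hlin x)
    choose σs hσ using fun i => ih i (hlin' i) (hQ c us hu i) (hus i) (h2 i) (h3 i)
    obtain ⟨σ, h1, h2, h3⟩ := exists_app_eq_app hps hlin (fun x e => Below (θ x) e ∧ Q e) hd σs
      fun i x => (hσ i).2.1 x
    refine ⟨σ, congrArg _ (funext fun i => ((hσ i).1.trans (h1 i))), h2, fun x hx => h3 x fun i =>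
      Finset.sum_eq_zero_iff.1 hx i (Finset.mem_univ i)⟩
  | fn f ps => exact h2.elim

/-- Extra variables receive `fill v (θ x)`, which contains no let-bound variable; this yields the
side condition of `LetRedex.fapp`. `Q` will be `IsExp` for term rewriting and `IsCTerm` for
let-rewriting. -/
theorem exists_match_rule {n : ℕ} [Nonempty V] {Q : LExp S V n → Prop}
    (hQ : ∀ c (es : Fin (S.arC c) → LExp S V n), Q (.con c es) → ∀ i, Q (es i))
    (hQ' : ∀ e : LExp S V n, e.IsCTerm → Q e)
    {R : Rule S V} (hR : R.IsProgramRule) {θ : V → LExp S V 0} (hθ : IsPCSubst θ)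
    {us : Fin (S.arF R.f) → LExp S V n} (hus : ∀ i, Q (us i))
    (h : ∀ i, Below ((R.pats i).app θ) (us i)) :
    ∃ σ : V → LExp S V n, us = (fun i => (R.pats i).app σ) ∧ FiniteDom σ ∧
      (∀ x, Below (θ x) (σ x) ∧ Q (σ x)) ∧
      ∀ x, (∀ i, (R.pats i).occ x = 0) → (σ x).NoBVar := by
  obtain ⟨v⟩ := ‹Nonempty V›
  obtain ⟨hps, hlin, -⟩ := hR
  have hd : ∀ x, Below (θ x) (fill v (θ x) : LExp S V n) ∧ Q (fill v (θ x)) := fun x =>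
    ⟨(hθ.2 x).1.below_fill v, hQ' _ ((hθ.2 x).fill v).1⟩
  have hlin' : ∀ i x, (R.pats i).occ x ≤ 1 := fun i x =>
    (Finset.single_le_sum (f := fun i => (R.pats i).occ x) (fun _ _ => Nat.zero_le _)
      (Finset.mem_univ i)).trans (hlin x)
  choose σs hσ using fun i => exists_match hQ hd (hps i) (hlin' i) (hus i) (h i)
  obtain ⟨σ, h1, h2, h3⟩ := exists_app_eq_app (fun i => (hps i).1) hlin
    (fun x e => Below (θ x) e ∧ Q e) hd σs fun i x => (hσ i).2.1 x
  refine ⟨σ, funext fun i => (hσ i).1.trans (h1 i), ?_, h2, fun x hx => ?_⟩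
  -- Off the pattern variables and the domain of `θ`, the default is `fill v (fvar x) = fvar x`.
  · refine (hθ.1.union (Set.finite_iUnion fun i => finite_occ (R.pats i))).subset fun x hx => ?_
    by_contra hc
    simp only [Set.mem_union, Set.mem_ofPred_eq, Set.mem_iUnion, not_or, not_exists, not_not] at hc
    exact hx ((h3 x hc.2).trans (by rw [hc.1]; rfl))
  · rw [h3 x hx]
    exact ((hθ.2 x).fill v).2

end Basic

end LExp

/-! ### CRWL-values and term rewriting -/

section Calculus

open LExp

variable {S : Signature} {V : Type*} {P : Program S V}

theorem CRWL.isPCTerm {e t : LExp S V 0} (h : CRWL P e t) : t.IsPCTerm := by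
  induction h with
  | B => exact isPCTerm_bot
  | RR x => exact isPCTerm_fvar x
  | DC c es ts _ ih => exact isPCTerm_con.2 ih
  | OR f ps r θ es t _ _ _ _ _ ih => exact ih

/-- Since `t` is a partial c-term, its values are its approximations; denotations are thus closed
downwards. -/
theorem CRWL.trans {e t u : LExp S V 0} (h : CRWL P e t) (h' : CRWL P t u) : CRWL P e u := by
  induction h generalizing u with
  | B => cases h' with | B => exact .B _
  | RR x => exact h'
  | DC c es ts _ ih =>
    cases h' with
    | B => exact .B _
    | DC _ _ us hus => exact .DC _ _ _ fun i => ih i (hus i)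
  | OR f ps r θ es t hR hθ hargs _ _ ih => exact .OR f ps r θ es u hR hθ hargs (ih h')

/-- At a `⊥` of `e` a derivation can only use `CRWL.B`, which applies to any expression. -/
theorem CRWL.mono {e e' t : LExp S V 0} (h : CRWL P e t) (he : Approx e e') : CRWL P e' t := by
  induction h generalizing e' with
  | B => exact .B _
  | RR x => cases he; exact .RR x
  | DC c es ts _ ih => cases he with | con _ _ es' h => exact .DC _ _ _ fun i => ih i (h i)
  | OR f ps r θ es t hR hθ _ hr ih _ =>
    cases he with | fn _ _ es' h => exact .OR f ps r θ _ t hR hθ (fun i => ih i (h i)) hr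

theorem CRWL.shell {e : LExp S V 0} (he : e.NoLet) : CRWL P e e.shell := by
  induction e, he using noLet_induction with
  | fvar x => exact .RR x
  | bot => exact .B _
  | con c es _ ih => exact .DC _ _ _ ih
  | fn f es _ ih => exact .B _

theorem CRWL.app {e : LExp S V 0} (he : e.IsPCTerm) {σ θ : V → LExp S V 0}
    (h : ∀ x, CRWL P (σ x) (θ x)) : CRWL P (e.app σ) (e.app θ) := by
  obtain ⟨h1, h2⟩ := he
  induction e, h1 using noLet_induction with
  | fvar x => exact h x
  | bot => exact .B _
  | con c es _ ih => exact .DC _ _ _ fun i => ih i (h2 i)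
  | fn f es _ ih => exact h2.elim

theorem CRWL.refl {t : LExp S V 0} (ht : t.IsPCTerm) : CRWL P t t := by
  obtain ⟨h1, h2⟩ := ht
  induction t, h1 using noLet_induction with
  | fvar x => exact .RR x
  | bot => exact .B _
  | con c es _ ih => exact .DC _ _ _ fun i => ih i (h2 i)
  | fn f es _ ih => exact h2.elim

/-! ### Rewriting decreases denotations in deterministic programs -/

theorem exists_upper_bound (hP : P.IsCRWLDeterministic) {e : LExp S V 0} (he : e.IsPExp)
    {ι : Type*} [Fintype ι] (ts : ι → LExp S V 0) (h : ∀ i, CRWL P e (ts i)) :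
    ∃ u, CRWL P e u ∧ ∀ i, Approx (ts i) u := by
  classical
  have key : ∀ s : Finset ι, ∃ u, CRWL P e u ∧ ∀ i ∈ s, Approx (ts i) u := by
    intro s
    induction s using Finset.induction_on with
    | empty => exact ⟨.bot, .B _, by simp⟩
    | insert i s _ ih =>
      obtain ⟨u, hu, hs⟩ := ih
      obtain ⟨w, hw, h1, h2⟩ := hP e he _ ⟨(h i).isPCTerm, h i⟩ _ ⟨hu.isPCTerm, hu⟩
      refine ⟨w, hw.2, fun j hj => ?_⟩
      rcases Finset.mem_insert.1 hj with rfl | hj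
      · exact h1
      · exact (hs j hj).trans h2
  obtain ⟨u, hu, h⟩ := key Finset.univ
  exact ⟨u, hu, fun i => h i (Finset.mem_univ i)⟩

theorem exists_subst_upper_bound (hP : P.IsCRWLDeterministic) {σ : V → LExp S V 0}
    (hσ : ∀ x, (σ x).IsPExp) {ι : Type*} [Fintype ι] (θs : ι → V → LExp S V 0)
    (h : ∀ i x, CRWL P (σ x) (θs i x)) (h' : ∀ i x, σ x = .fvar x → θs i x = .fvar x) :
    ∃ θ : V → LExp S V 0, (∀ x, CRWL P (σ x) (θ x)) ∧ (∀ x, σ x = .fvar x → θ x = .fvar x) ∧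
      ∀ i x, Approx (θs i x) (θ x) := by
  have key : ∀ x, ∃ u, CRWL P (σ x) u ∧ (σ x = .fvar x → u = .fvar x) ∧
      ∀ i, Approx (θs i x) u := by
    intro x
    -- Variables fixed by `σ` stay fixed, so that the bound inherits a finite domain from `σ`.
    by_cases hx : σ x = .fvar x
    · refine ⟨.fvar x, by rw [hx]; exact .RR x, fun _ => rfl, fun i => ?_⟩
      rw [h' i x hx]
      exact .fvar x
    · obtain ⟨u, hu, hu'⟩ := exists_upper_bound hP (hσ x) (fun i => θs i x) fun i => h i x
      exact ⟨u, hu, fun h => (hx h).elim, hu'⟩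
  choose θ h1 h2 h3 using key
  exact ⟨θ, h1, h2, fun i x => h3 x i⟩

/-- The heart of the matter. By induction on `e`, each argument yields its own value for every `σ
x`; determinism bounds these values by a single one, and `CRWL.mono` carries the derivations over to
it. -/
theorem CRWL.exists_pcSubst (hP : P.IsCRWLDeterministic) {σ : V → LExp S V 0}
    (hσ : ∀ x, (σ x).IsPExp) {e t : LExp S V 0} (he : e.NoLet) (h : CRWL P (e.app σ) t) :
    ∃ θ : V → LExp S V 0, (∀ x, CRWL P (σ x) (θ x)) ∧ (∀ x, σ x = .fvar x → θ x = .fvar x) ∧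
      CRWL P (e.app θ) t := by
  classical
  have hbot : ∀ e' : LExp S V 0, ∃ θ : V → LExp S V 0, (∀ x, CRWL P (σ x) (θ x)) ∧
      (∀ x, σ x = .fvar x → θ x = .fvar x) ∧ CRWL P (e'.app θ) .bot := fun e' => by
    refine ⟨fun x => if σ x = .fvar x then .fvar x else .bot, fun x => ?_, fun x hx => if_pos hx,
      .B _⟩
    dsimp only
    split_ifs with hx
    · rw [hx]; exact .RR x
    · exact .B _
  induction e, he using noLet_induction generalizing t with
  | fvar y =>
    obtain ⟨θ, h1, h2, -⟩ := hbot .bot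
    by_cases hy : σ y = .fvar y
    · refine ⟨θ, h1, h2, ?_⟩
      rw [app_fvar] at h ⊢
      rwa [h2 y hy, ← hy]
    · refine ⟨Function.update θ y t, fun x => ?_, fun x hx => ?_, ?_⟩
      · by_cases hx : x = y
        · subst hx; simpa using h
        · simpa [hx] using h1 x
      · have hxy : x ≠ y := fun hxy => hy (hxy ▸ hx)
        simpa [hxy] using h2 x hx
      · simpa using CRWL.refl h.isPCTerm
  | bot =>
    cases h
    exact hbot _
  | con c es he ih =>
    cases h with
    | B => exact hbot _
    | DC _ _ ts hts =>
      choose θs h1 h2 h3 using fun i => ih i (hts i)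
      obtain ⟨θ, h4, h5, h6⟩ := exists_subst_upper_bound hP hσ θs h1 h2
      exact ⟨θ, h4, h5, .DC _ _ _ fun i => (h3 i).mono ((he i).approx_app (h6 i))⟩
  | fn f es he ih =>
    cases h with
    | B => exact hbot _
    | OR _ ps r θ' _ _ hR hθ' hargs hr =>
      choose θs h1 h2 h3 using fun i => ih i (hargs i)
      obtain ⟨θ, h4, h5, h6⟩ := exists_subst_upper_bound hP hσ θs h1 h2
      exact ⟨θ, h4, h5, .OR _ _ _ _ _ _ hR hθ'
        (fun i => (h3 i).mono ((he i).approx_app (h6 i))) hr⟩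

/-- The `θ` extracted from the right-hand side serves in `CRWL.OR`, because the patterns are c-terms
and so evaluate from their `σ`-instance to their `θ`-instance. -/
theorem CRWL.of_rhs (hP : P.IsCRWLDeterministic) {R : Rule S V} (hR : R ∈ P.rules)
    {σ : V → LExp S V 0} (hσ : IsSubst σ) {t : LExp S V 0} (h : CRWL P (R.rhs.app σ) t) :
    CRWL P (.fn R.f fun i => (R.pats i).app σ) t := by
  obtain ⟨hps, -, hr⟩ := P.isProgramRule R hR
  obtain ⟨θ, h1, h2, h3⟩ := CRWL.exists_pcSubst hP (fun x => (hσ.2 x).1) hr.1 h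
  refine .OR R.f R.pats R.rhs θ _ t hR ⟨?_, fun x => (h1 x).isPCTerm⟩
    (fun i => CRWL.app (hps i).isPCTerm h1) h3
  exact hσ.1.subset fun x hx hx' => hx (h2 x hx')

/-- The equation `h0` lets the depth vary in the induction; contexts passing through a let are
harmless, as CRWL gives a let only the value `⊥`. -/
theorem CRWL.plug {n : ℕ} (C : Ctx S V 0 n) (h0 : n = 0) {a b : LExp S V 0}
    (h : ∀ t, CRWL P a t → CRWL P b t) {t : LExp S V 0} (ht : CRWL P (h0 ▸ C.plug a) t) :
    CRWL P (h0 ▸ C.plug b) t := by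
  induction C generalizing t with
  | hole => exact h t ht
  | con c i es C ih =>
    subst h0
    cases ht with
    | B => exact .B _
    | DC _ _ ts hts =>
      refine .DC _ _ _ fun j => ?_
      have := hts j
      by_cases hj : j = i
      · subst hj
        rw [Function.update_self] at this ⊢
        exact ih rfl this
      · rwa [Function.update_of_ne hj] at this ⊢
  | fn f i es C ih =>
    subst h0
    cases ht with
    | B => exact .B _
    | OR _ ps r θ _ _ hR hθ hargs hr =>
      refine .OR _ _ _ _ _ _ hR hθ (fun j => ?_) hr
      have := hargs j
      by_cases hj : j = i
      · subst hj
        rw [Function.update_self] at this ⊢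
        exact ih rfl this
      · rwa [Function.update_of_ne hj] at this ⊢
  | letDef C b ih =>
    subst h0
    cases ht
    exact .B _
  | letBody a C ih =>
    subst h0
    cases ht
    exact .B _

theorem CRWL.of_rwSteps (hP : P.IsCRWLDeterministic) {e e' t : LExp S V 0}
    (h : RwSteps P e e') (ht : CRWL P e' t) : CRWL P e t := by
  induction h using Relation.ReflTransGen.head_induction_on with
  | refl => exact ht
  | head h _ ih =>
    obtain ⟨-, C, R, σ, hR, hσ, rfl, rfl⟩ := h
    exact CRWL.plug C rfl (fun t => CRWL.of_rhs hP hR hσ) ih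

/-! ### CRWL-values are reached by rewriting -/

theorem reflTransGen_pi {ι α β : Type*} [Fintype ι] [DecidableEq ι] {r : α → α → Prop}
    {s : β → β → Prop} (F : (ι → α) → β)
    (hF : ∀ es i a, r (es i) a → s (F es) (F (Function.update es i a))) {es es' : ι → α}
    (h : ∀ i, Relation.ReflTransGen r (es i) (es' i)) :
    Relation.ReflTransGen s (F es) (F es') := by
  have one : ∀ es i a, Relation.ReflTransGen r (es i) a →
      Relation.ReflTransGen s (F es) (F (Function.update es i a)) := by
    intro es i a ha
    induction ha with
    | refl => rw [Function.update_eq_self]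
    | tail _ hab ih =>
      have := hF (Function.update es i _) i _ (by rwa [Function.update_self])
      rw [Function.update_idem] at this
      exact ih.tail this
  -- The coordinates are moved one at a time; those in `u` have been moved.
  have key : ∀ u : Finset ι,
      Relation.ReflTransGen s (F es) (F fun i => if i ∈ u then es' i else es i) := by
    intro u
    induction u using Finset.induction_on with
    | empty => simpa using .refl
    | insert i u hi ih =>
      refine ih.trans ?_
      have := one (fun j => if j ∈ u then es' j else es j) i (es' i) (by simpa [hi] using h i)
      convert this using 2
      ext j
      by_cases hj : j = i
      · subst hj; simp
      · simp [hj]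
  simpa using key Finset.univ

theorem Ctx.noBot_plug {n m : ℕ} (C : Ctx S V m n) {a b : LExp S V m}
    (h : a.NoBot → b.NoBot) (hC : (C.plug a).NoBot) : (C.plug b).NoBot := by
  induction C with
  | hole => exact h hC
  | con c i es C ih =>
    intro j
    have := hC j
    by_cases hj : j = i
    · subst hj
      rw [Function.update_self] at this ⊢
      exact ih this
    · rwa [Function.update_of_ne hj] at this ⊢
  | fn c i es C ih =>
    intro j
    have := hC j
    by_cases hj : j = i
    · subst hj
      rw [Function.update_self] at this ⊢
      exact ih this
    · rwa [Function.update_of_ne hj] at this ⊢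
  | letDef C b ih => exact ⟨ih hC.1, hC.2⟩
  | letBody a C ih => exact ⟨hC.1, ih hC.2⟩

theorem Ctx.noLet_plug {n : ℕ} (C : Ctx S V 0 n) {a b : LExp S V 0}
    (h : a.NoLet → b.NoLet) (hC : (C.plug a).NoLet) : (C.plug b).NoLet := by
  induction C with
  | hole => exact h hC
  | con c i es C ih =>
    intro j
    have := hC j
    by_cases hj : j = i
    · subst hj
      rw [Function.update_self] at this ⊢
      exact ih this
    · rwa [Function.update_of_ne hj] at this ⊢
  | fn c i es C ih =>
    intro j
    have := hC j
    by_cases hj : j = i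
    · subst hj
      rw [Function.update_self] at this ⊢
      exact ih this
    · rwa [Function.update_of_ne hj] at this ⊢
  | letDef C b ih => exact hC.elim
  | letBody a C ih => exact hC.elim

/-- A rewriting step on arbitrary expressions. -/
def PreRwStep (P : Program S V) (e e' : LExp S V 0) : Prop :=
  ∃ (C : Ctx S V 0 0) (R : Rule S V) (σ : V → LExp S V 0),
    R ∈ P.rules ∧ IsSubst σ ∧
    e = C.plug (.fn R.f (fun i => (R.pats i).app σ)) ∧ e' = C.plug (R.rhs.app σ)

theorem PreRwStep.isExp {e e' : LExp S V 0} (h : PreRwStep P e e') (he : e.IsExp) :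
    e'.IsExp := by
  obtain ⟨C, R, σ, hR, hσ, rfl, rfl⟩ := h
  have hr := (P.isProgramRule R hR).2.2.app hσ.2
  exact ⟨C.noLet_plug (fun _ => hr.1) he.1, C.noBot_plug (fun _ => hr.2) he.2⟩

/-- Membership in `Exp` propagates from the start, so congruence under symbols can be proved without
checking the sibling arguments. -/
theorem rwSteps_of_preRwSteps {e e' : LExp S V 0} (h : Relation.ReflTransGen (PreRwStep P) e e')
    (he : e.IsExp) : RwSteps P e e' ∧ e'.IsExp := by
  induction h with
  | refl => exact ⟨.refl, he⟩
  | tail _ hstep ih => exact ⟨ih.1.tail ⟨ih.2, hstep⟩, hstep.isExp ih.2⟩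

theorem PreRwStep.con {c : S.CS} (es : Fin (S.arC c) → LExp S V 0)
    (i : Fin (S.arC c)) (a : LExp S V 0) (h : PreRwStep P (es i) a) :
    PreRwStep P (.con c es) (.con c (Function.update es i a)) := by
  obtain ⟨C, R, σ, hR, hσ, h1, rfl⟩ := h
  refine ⟨.con c i es C, R, σ, hR, hσ, ?_, rfl⟩
  rw [Ctx.plug, ← h1, Function.update_eq_self]

theorem PreRwStep.fn {f : S.FS} (es : Fin (S.arF f) → LExp S V 0)
    (i : Fin (S.arF f)) (a : LExp S V 0) (h : PreRwStep P (es i) a) :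
    PreRwStep P (.fn f es) (.fn f (Function.update es i a)) := by
  obtain ⟨C, R, σ, hR, hσ, h1, rfl⟩ := h
  refine ⟨.fn f i es C, R, σ, hR, hσ, ?_, rfl⟩
  rw [Ctx.plug, ← h1, Function.update_eq_self]

theorem preRwSteps_isExp {e e' : LExp S V 0} (h : Relation.ReflTransGen (PreRwStep P) e e')
    (he : e.IsExp) : e'.IsExp := (rwSteps_of_preRwSteps h he).2

/-- The start must be any `e₁` above `e`: `CRWL.OR` continues with the partial `r.app θ`, rewriting
with `r.app σ` for a total `σ` above `θ`. -/
theorem CRWL.exists_preRwSteps [Nonempty V] {e t : LExp S V 0} (h : CRWL P e t)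
    {e₁ : LExp S V 0} (he : Below e e₁) (he₁ : e₁.IsExp) :
    ∃ e', Relation.ReflTransGen (PreRwStep P) e₁ e' ∧ Below t e' := by
  induction h generalizing e₁ with
  | B => exact ⟨e₁, .refl, .bot _⟩
  | RR x => exact ⟨e₁, .refl, he⟩
  | DC c es ts _ ih =>
    cases he with | con _ _ es₁ hes =>
    choose es' h1 h2 using fun i => ih i (hes i) (isExp_con.1 he₁ i)
    exact ⟨.con c es', reflTransGen_pi (LExp.con c) PreRwStep.con h1, .con _ _ _ h2⟩
  | OR f ps r θ es t hR hθ _ _ ih ihr =>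
    cases he with | fn _ _ es₁ hes =>
    choose es' h1 h2 using fun i => ih i (hes i) (isExp_fn.1 he₁ i)
    have hrule := P.isProgramRule _ hR
    obtain ⟨σ, rfl, hσ, hB, -⟩ := exists_match_rule (Q := IsExp) (fun c es h => isExp_con.1 h)
      (fun e h => h.isExp) hrule hθ
      (fun i => preRwSteps_isExp (h1 i) (isExp_fn.1 he₁ i)) h2
    have hr := hrule.2.2
    obtain ⟨e', h3, h4⟩ := ihr (hr.1.below_app fun x => (hB x).1) (hr.app fun x => (hB x).2)
    refine ⟨e', ?_, h4⟩
    refine (reflTransGen_pi (LExp.fn f) PreRwStep.fn h1).trans (.head ?_ h3)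
    exact ⟨.hole, ⟨f, ps, r⟩, σ, hR, ⟨hσ, fun x => (hB x).2⟩, rfl, rfl⟩

theorem CRWL.rwSteps [Nonempty V] {e t : LExp S V 0} (h : CRWL P e t) (he : e.IsExp)
    (ht : t.IsCTerm) : RwSteps P e t := by
  obtain ⟨e', h1, h2⟩ := h.exists_preRwSteps he.1.below_refl he
  obtain ⟨v⟩ := ‹Nonempty V›
  rw [h2.eq_fill v ht.2.2, fill_self v ht.isExp] at h1
  exact (rwSteps_of_preRwSteps h1 he).1

end Calculus

/-! ### Let-rewriting creates no CRWL-values -/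

section Soundness

open LExp

variable {S : Signature} {V : Type*} {P : Program S V}

/-- The values of a let-expression whose let-bound variables have the values `τ`. -/
def LetDen (P : Program S V) : {n : ℕ} → LExp S V n → (Fin n → LExp S V 0) → LExp S V 0 → Prop
  | _, .fvar x, _, t => t = .bot ∨ t = .fvar x
  | _, .bvar i, τ, t => CRWL P (τ i) t
  | _, .bot, _, t => t = .bot
  | _, .con c es, τ, t => t = .bot ∨ ∃ ts, t = .con c ts ∧ ∀ i, LetDen P (es i) τ (ts i)
  | _, .fn f es, τ, t => t = .bot ∨ ∃ (ps : Fin (S.arF f) → LExp S V 0) (r : LExp S V 0)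
      (θ : V → LExp S V 0), (⟨f, ps, r⟩ : Rule S V) ∈ P.rules ∧ IsPCSubst θ ∧
        (∀ i, LetDen P (es i) τ ((ps i).app θ)) ∧ CRWL P (r.app θ) t
  | _, .letIn a b, τ, t => ∃ u : LExp S V 0, u.IsPCTerm ∧ LetDen P a τ u ∧
      LetDen P b (Fin.cons u τ) t

theorem LetDen.bot {n : ℕ} (e : LExp S V n) (τ : Fin n → LExp S V 0) : LetDen P e τ .bot := by
  induction e with
  | fvar x => exact .inl rfl
  | bvar i => exact .B _
  | bot => rfl
  | con c es => exact .inl rfl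
  | fn f es => exact .inl rfl
  | letIn a b iha ihb => exact ⟨.bot, isPCTerm_bot, iha τ, ihb _⟩

theorem CRWL.eq_bot {t : LExp S V 0} (h : CRWL P .bot t) : t = .bot := by
  cases h
  rfl

theorem LetDen.trans {n : ℕ} {e : LExp S V n} {τ : Fin n → LExp S V 0} {t u : LExp S V 0}
    (h : LetDen P e τ t) (h' : CRWL P t u) : LetDen P e τ u := by
  induction e generalizing t u with
  | fvar x =>
    rcases h with rfl | rfl
    · exact .inl h'.eq_bot
    · cases h' with
      | B => exact .inl rfl
      | RR => exact .inr rfl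
  | bvar i => exact CRWL.trans h h'
  | bot =>
    cases h
    exact h'.eq_bot
  | con c es ih =>
    rcases h with rfl | ⟨ts, rfl, hts⟩
    · exact .inl h'.eq_bot
    · cases h' with
      | B => exact .inl rfl
      | DC _ _ us hus => exact .inr ⟨us, rfl, fun i => ih i (hts i) (hus i)⟩
  | fn f es ih =>
    rcases h with rfl | ⟨ps, r, θ, hR, hθ, h1, h2⟩
    · exact .inl h'.eq_bot
    · exact .inr ⟨ps, r, θ, hR, hθ, h1, h2.trans h'⟩
  | letIn a b _ ihb =>
    obtain ⟨w, hw, h1, h2⟩ := h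
    exact ⟨w, hw, h1, ihb h2 h'⟩

theorem letDen_rename {n m : ℕ} {e : LExp S V n} {ρ : Fin n → Fin m} {τ : Fin m → LExp S V 0}
    {t : LExp S V 0} : LetDen P (e.rename ρ) τ t ↔ LetDen P e (fun i => τ (ρ i)) t := by
  induction e generalizing m t with
  | fvar x => rfl
  | bvar i => rfl
  | bot => rfl
  | con c es ih =>
    simp only [LExp.rename, LetDen, ih]
  | fn f es ih =>
    simp only [LExp.rename, LetDen, ih]
  | letIn a b iha ihb =>
    simp only [LExp.rename, LetDen, iha, ihb]
    refine exists_congr fun u => and_congr_right fun _ => and_congr_right fun _ => ?_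
    refine iff_of_eq (congrArg (fun τ => LetDen P b τ t) (funext fun i => ?_))
    refine Fin.cases ?_ (fun j => ?_) i <;> rfl

theorem letDen_weaken {n : ℕ} {e : LExp S V n} {τ : Fin n → LExp S V 0} {u t : LExp S V 0} :
    LetDen P e.weaken (Fin.cons u τ : Fin (n + 1) → LExp S V 0) t ↔ LetDen P e τ t :=
  letDen_rename

theorem LExp.NoLet.letDen_iff {n : ℕ} {e : LExp S V n} (he : e.NoLet) {τ : Fin n → LExp S V 0}
    {t : LExp S V 0} : LetDen P e τ t ↔ CRWL P (e.subst fvar τ) t := by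
  induction e generalizing t with
  | fvar x =>
    constructor
    · rintro (rfl | rfl)
      · exact .B _
      · exact .RR x
    · intro h
      cases h with
      | B => exact .inl rfl
      | RR => exact .inr rfl
  | bvar i => rfl
  | bot =>
    constructor
    · rintro rfl
      exact .B _
    · exact CRWL.eq_bot
  | con c es ih =>
    constructor
    · rintro (rfl | ⟨ts, rfl, hts⟩)
      · exact .B _
      · exact .DC _ _ _ fun i => (ih i (he i)).1 (hts i)
    · intro h
      cases h with
      | B => exact .inl rfl
      | DC _ _ ts hts => exact .inr ⟨ts, rfl, fun i => (ih i (he i)).2 (hts i)⟩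
  | fn f es ih =>
    constructor
    · rintro (rfl | ⟨ps, r, θ, hR, hθ, h1, h2⟩)
      · exact .B _
      · exact .OR _ _ _ _ _ _ hR hθ (fun i => (ih i (he i)).1 (h1 i)) h2
    · intro h
      cases h with
      | B => exact .inl rfl
      | OR _ ps r θ _ _ hR hθ h1 h2 =>
        exact .inr ⟨ps, r, θ, hR, hθ, fun i => (ih i (he i)).2 (h1 i), h2⟩
  | letIn a b => exact he.elim

theorem LExp.NoLet.subst_weaken {n m : ℕ} {e : LExp S V n} (he : e.NoLet)
    (u : LExp S V m) (τ : Fin n → LExp S V m) :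
    e.weaken.subst fvar (Fin.cons u τ : Fin (n + 1) → LExp S V m) = e.subst fvar τ := by
  rw [LExp.weaken, rename_eq_subst, he.subst_subst]
  rfl

/-- A c-term in the environment `τ` has its own instance as greatest value, so sharing that value
loses nothing against copying the c-term. -/
theorem LetDen.of_subst {n m : ℕ} {e : LExp S V n} {ν : Fin n → LExp S V m}
    (hν : ∀ i, (ν i).IsCTerm) {τ : Fin m → LExp S V 0} {t : LExp S V 0}
    (h : LetDen P (e.subst fvar ν) τ t) : LetDen P e (fun i => (ν i).subst fvar τ) t := by
  induction e generalizing m t with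
  | fvar x => exact h
  | bvar i => exact (hν i).1.letDen_iff.1 h
  | bot => exact h
  | con c es ih =>
    rcases h with rfl | ⟨ts, rfl, hts⟩
    · exact .inl rfl
    · exact .inr ⟨ts, rfl, fun i => ih i hν (hts i)⟩
  | fn f es ih =>
    rcases h with rfl | ⟨ps, r, θ, hR, hθ, h1, h2⟩
    · exact .inl rfl
    · exact .inr ⟨ps, r, θ, hR, hθ, fun i => ih i hν (h1 i), h2⟩
  | letIn a b iha ihb =>
    obtain ⟨u, hu, h1, h2⟩ := h
    refine ⟨u, hu, iha hν h1, ?_⟩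
    have := ihb (m := m + 1) (ν := Fin.cons (.bvar 0) fun i => (ν i).weaken) (fun i => ?_) h2
    · convert this using 1
      funext i
      refine Fin.cases rfl (fun j => ?_) i
      exact ((hν j).1.subst_weaken u τ).symm
    · exact Fin.cases (isCTerm_bvar 0) (fun j => (hν j).weaken) i

/-- For a function application, `θ` followed by the environment is the substitution needed in
`CRWL.OR`; the other rules rearrange or supply the value chosen for a let. -/
theorem LetRedex.letDen {n : ℕ} {e e' : LExp S V n} (h : LetRedex P e e')
    {τ : Fin n → LExp S V 0} (hτ : ∀ i, (τ i).IsPCTerm) {t : LExp S V 0}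
    (ht : LetDen P e' τ t) : LetDen P e τ t := by
  cases h with
  | fapp f ps r θ hR hθ _ =>
    obtain ⟨hps, -, hr⟩ := P.isProgramRule _ hR
    have hcomp : ∀ e : LExp S V 0, e.NoLet →
        (e.app θ).subst fvar τ = e.app (fun x => (θ x).subst fvar τ) := fun e he => by
      rw [LExp.app, he.subst_subst]
      exact congrArg (fun ν => LExp.subst _ ν e) (funext fun i => Fin.elim0 i)
    have hθ' : ∀ x, ((θ x).subst fvar τ).IsPCTerm := fun x =>
      (hθ.2 x).isPCTerm.subst isPCTerm_fvar hτ
    refine .inr ⟨ps, r, fun x => (θ x).subst fvar τ, hR, ⟨?_, hθ'⟩, fun i => ?_, ?_⟩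
    -- The environment replaces let-bound variables only, so free variables fixed by `θ` remain
    -- fixed.
    · exact hθ.1.subset fun x hx hx' => hx (by dsimp only; rw [hx']; rfl)
    · have hp : ((ps i).app θ).IsCTerm := (hps i).subst (fun x => hθ.2 x) (fun i => i.elim0)
      change LetDen P ((ps i).app θ) τ _
      rw [hp.1.letDen_iff]
      rw [hcomp _ (hps i).1]
      exact CRWL.refl ((hps i).isPCTerm.subst hθ' fun i => i.elim0)
    · have hl : (r.app θ).NoLet := hr.1.subst (fun x => (hθ.2 x).1) fun i => i.elim0
      rwa [← hcomp _ hr.1, ← hl.letDen_iff]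
  | letInCon c es i _ =>
    obtain ⟨u, hu, h1, h2⟩ := ht
    rcases h2 with rfl | ⟨ts, rfl, hts⟩
    · exact .inl rfl
    · refine .inr ⟨ts, rfl, fun j => ?_⟩
      have := hts j
      by_cases hj : j = i
      · subst hj
        rw [Function.update_self] at this
        -- The new variable evaluates to an approximation of the shared value `u`, hence so does the
        -- hoisted argument.
        exact h1.trans this
      · rw [Function.update_of_ne hj] at this
        exact letDen_weaken.1 this
  | letInFn f es i _ =>
    obtain ⟨u, hu, h1, h2⟩ := ht
    rcases h2 with rfl | ⟨ps, r, θ, hR, hθ, hts, h2⟩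
    · exact .inl rfl
    · refine .inr ⟨ps, r, θ, hR, hθ, fun j => ?_, h2⟩
      have := hts j
      by_cases hj : j = i
      · subst hj
        rw [Function.update_self] at this
        exact h1.trans this
      · rw [Function.update_of_ne hj] at this
        exact letDen_weaken.1 this
  | bind s b hs =>
    have hs' : (s.subst fvar τ).IsPCTerm := hs.isPCTerm.subst isPCTerm_fvar hτ
    refine ⟨s.subst fvar τ, hs', hs.1.letDen_iff.2 (CRWL.refl hs'), ?_⟩
    have := LetDen.of_subst (ν := Fin.cons s LExp.bvar) (fun i => ?_) ht
    · convert this using 1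
      funext i
      refine Fin.cases rfl (fun j => rfl) i
    · exact Fin.cases hs (fun j => isCTerm_bvar j) i
  -- The discarded definiens is given the value `⊥`, which every expression has.
  | elim a b => exact ⟨.bot, isPCTerm_bot, LetDen.bot _ _, letDen_weaken.2 ht⟩
  | flat e₁ e₂ e₃ =>
    obtain ⟨u, hu, h1, w, hw, h2, h3⟩ := ht
    refine ⟨w, hw, ⟨u, hu, h1, h2⟩, ?_⟩
    rw [letDen_rename] at h3
    convert h3 using 1
    funext i
    refine Fin.cases rfl (fun j => rfl) i

theorem LetDen.plug {n m : ℕ} (C : Ctx S V m n) {a b : LExp S V m}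
    (h : ∀ τ : Fin m → LExp S V 0, (∀ i, (τ i).IsPCTerm) → ∀ t, LetDen P a τ t → LetDen P b τ t)
    {τ : Fin n → LExp S V 0} (hτ : ∀ i, (τ i).IsPCTerm) {t : LExp S V 0}
    (ht : LetDen P (C.plug a) τ t) : LetDen P (C.plug b) τ t := by
  induction C generalizing t with
  | hole => exact h τ hτ t ht
  | con c i es C ih =>
    rcases ht with rfl | ⟨ts, rfl, hts⟩
    · exact .inl rfl
    · refine .inr ⟨ts, rfl, fun j => ?_⟩
      have := hts j
      by_cases hj : j = i
      · subst hj
        rw [Function.update_self] at this ⊢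
        exact ih hτ this
      · rwa [Function.update_of_ne hj] at this ⊢
  | fn f i es C ih =>
    rcases ht with rfl | ⟨ps, r, θ, hR, hθ, hts, h2⟩
    · exact .inl rfl
    · refine .inr ⟨ps, r, θ, hR, hθ, fun j => ?_, h2⟩
      have := hts j
      by_cases hj : j = i
      · subst hj
        rw [Function.update_self] at this ⊢
        exact ih hτ this
      · rwa [Function.update_of_ne hj] at this ⊢
  | letDef C b ih =>
    obtain ⟨u, hu, h1, h2⟩ := ht
    exact ⟨u, hu, ih hτ h1, h2⟩
  | letBody a C ih =>
    obtain ⟨u, hu, h1, h2⟩ := ht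
    exact ⟨u, hu, h1, ih (fun i => Fin.cases hu hτ i) h2⟩

theorem LetSteps.letDen {n : ℕ} {e e' : LExp S V n} (h : LetSteps P e e')
    {τ : Fin n → LExp S V 0} (hτ : ∀ i, (τ i).IsPCTerm) {t : LExp S V 0}
    (ht : LetDen P e' τ t) : LetDen P e τ t := by
  induction h using Relation.ReflTransGen.head_induction_on with
  | refl => exact ht
  | head h _ ih =>
    obtain ⟨m, C, a, a', hr, rfl, rfl⟩ := h
    exact LetDen.plug C (fun τ hτ t => hr.letDen hτ) hτ ih

theorem LetSteps.crwl {e t : LExp S V 0} (h : LetSteps P e t) (he : e.NoLet)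
    (ht : t.IsPCTerm) : CRWL P e t := by
  have h0 : ∀ i : Fin 0, ((Fin.elim0 i : LExp S V 0)).IsPCTerm := fun i => i.elim0
  have := h.letDen h0 (ht.1.letDen_iff.2 (by rw [ht.1.app_id]; exact CRWL.refl ht))
  rwa [he.letDen_iff, he.app_id] at this

end Soundness

/-! ### Let-rewriting down to a telescope above a given value -/

section Completeness

open LExp

variable {S : Signature} {V : Type*} {P : Program S V}

/-- A family of properties of let-expressions is stable if it is preserved by the substitution of
c-terms for let-bound variables. -/
def Stable (K : (n : ℕ) → LExp S V n → Prop) : Prop :=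
  ∀ (n m : ℕ) (e : LExp S V n) (τ : Fin n → LExp S V m), (∀ i, (τ i).IsCTerm) → K n e →
    K m (e.subst fvar τ)

theorem Stable.rename {K : (n : ℕ) → LExp S V n → Prop} (hK : Stable K) {n m : ℕ}
    {e : LExp S V n} (ρ : Fin n → Fin m) (h : K n e) : K m (e.rename ρ) := by
  rw [rename_eq_subst]
  exact hK n m e _ (fun i => isCTerm_bvar _) h

theorem Stable.inst {K : (n : ℕ) → LExp S V n → Prop} (hK : Stable K) {n : ℕ}
    {e : LExp S V (n + 1)} {t : LExp S V n} (ht : t.IsCTerm) (h : K (n + 1) e) :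
    K n (e.inst t) :=
  hK _ _ e _ (fun i => Fin.cases ht (fun j => isCTerm_bvar j) i) h

/-- Telescopes of `let`s whose innermost body satisfies `Φ`. -/
inductive Telescope (Φ : (n : ℕ) → LExp S V n → Prop) : {n : ℕ} → LExp S V n → Prop
  | base {n : ℕ} (e : LExp S V n) (h : Φ n e) : Telescope Φ e
  | letIn {n : ℕ} (a : LExp S V n) (b : LExp S V (n + 1)) (h : Telescope Φ b) :
      Telescope Φ (.letIn a b)

theorem Telescope.stable {Φ : (n : ℕ) → LExp S V n → Prop} (hΦ : Stable Φ) :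
    Stable (fun _ e => Telescope Φ e) := by
  intro n m e τ hτ h
  induction h generalizing m with
  | base e h => exact .base _ (hΦ _ _ _ _ hτ h)
  | letIn a b _ ih =>
    refine .letIn _ _ (ih _ _ fun i => ?_)
    exact Fin.cases (isCTerm_bvar 0) (fun j => (hτ j).weaken) i

/-- Let-rewriting, also inside bodies of `let`s, leads to an expression that satisfies `Φ`. -/
inductive Reach (P : Program S V) (Φ : (n : ℕ) → LExp S V n → Prop) :
    {n : ℕ} → LExp S V n → Prop
  | base {n : ℕ} (e : LExp S V n) (h : Φ n e) : Reach P Φ e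
  | step {n : ℕ} (e e' : LExp S V n) (h : LetStep P e e') (h' : Reach P Φ e') : Reach P Φ e
  | letIn {n : ℕ} (a : LExp S V n) (b : LExp S V (n + 1)) (h : Reach P Φ b) :
      Reach P Φ (.letIn a b)

theorem Reach.of_letSteps {Φ : (n : ℕ) → LExp S V n → Prop} {n : ℕ} {e e' : LExp S V n}
    (h : LetSteps P e e') (h' : Reach P Φ e') : Reach P Φ e := by
  induction h using Relation.ReflTransGen.head_induction_on with
  | refl => exact h'
  | head h _ ih => exact .step _ _ h ih

theorem Reach.bind {Φ Ψ : (n : ℕ) → LExp S V n → Prop} {n : ℕ} {e : LExp S V n}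
    (h : Reach P Φ e) (h' : ∀ n e, Φ n e → Reach P Ψ e) : Reach P Ψ e := by
  induction h with
  | base e h => exact h' _ _ h
  | step e e' h _ ih => exact .step e e' h ih
  | letIn a b _ ih => exact .letIn a b ih

theorem LetRedex.letStep {n : ℕ} {e e' : LExp S V n} (h : LetRedex P e e') : LetStep P e e' :=
  ⟨n, .hole, e, e', h, rfl, rfl⟩

theorem LetStep.letBody {n : ℕ} (a : LExp S V n) {b b' : LExp S V (n + 1)} (h : LetStep P b b') :
    LetStep P (.letIn a b) (.letIn a b') := by
  obtain ⟨m, C, r, r', hr, rfl, rfl⟩ := h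
  exact ⟨m, .letBody a C, r, r', hr, rfl, rfl⟩

theorem LetSteps.letBody {n : ℕ} (a : LExp S V n) {b b' : LExp S V (n + 1)}
    (h : LetSteps P b b') : LetSteps P (.letIn a b) (.letIn a b') :=
  Relation.ReflTransGen.lift (LExp.letIn a) (fun _ _ h => LetStep.letBody a h) _ _ h

/-- The lets entered by `Reach.letIn` become the telescope, and steps in a body are steps of the
whole. -/
theorem Reach.exists_telescope {Φ : (n : ℕ) → LExp S V n → Prop} {n : ℕ} {e : LExp S V n}
    (h : Reach P Φ e) : ∃ e', LetSteps P e e' ∧ Telescope Φ e' := by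
  induction h with
  | base e h => exact ⟨e, .refl, .base e h⟩
  | step e e' h _ ih =>
    obtain ⟨e'', h1, h2⟩ := ih
    exact ⟨e'', .head h h1, h2⟩
  | letIn a b _ ih =>
    obtain ⟨b', h1, h2⟩ := ih
    exact ⟨_, h1.letBody a, .letIn a b' h2⟩

/-! ### Arguments of symbols -/

/-- The arity of a constructor or function symbol. -/
def symArity (h : S.CS ⊕ S.FS) : ℕ := Sum.elim S.arC S.arF h

/-- The expression `h(e₁, …, eₙ)` for a constructor or function symbol `h`. -/
def symApp {n : ℕ} : (h : S.CS ⊕ S.FS) → (Fin (symArity h) → LExp S V n) → LExp S V n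
  | .inl c, es => .con c es
  | .inr f, es => .fn f es

theorem LetStep.symApp {n : ℕ} (h : S.CS ⊕ S.FS) (es : Fin (symArity h) → LExp S V n)
    (i : Fin (symArity h)) (a : LExp S V n) (hs : LetStep P (es i) a) :
    LetStep P (symApp h es) (symApp h (Function.update es i a)) := by
  obtain ⟨m, C, r, r', hr, h1, rfl⟩ := hs
  cases h with
  | inl c =>
    refine ⟨m, .con c i es C, r, r', hr, ?_, rfl⟩
    change LExp.con c es = LExp.con c (Function.update es i (C.plug r))
    rw [← h1]
    exact congrArg (LExp.con c) (Function.update_eq_self i es).symm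
  | inr f =>
    refine ⟨m, .fn f i es C, r, r', hr, ?_, rfl⟩
    change LExp.fn f es = LExp.fn f (Function.update es i (C.plug r))
    rw [← h1]
    exact congrArg (LExp.fn f) (Function.update_eq_self i es).symm

theorem letStep_letIn {n : ℕ} (h : S.CS ⊕ S.FS) (es : Fin (symArity h) → LExp S V n)
    (i : Fin (symArity h)) (hi : (es i).IsFnOrLet) :
    LetStep P (symApp h es)
      (.letIn (es i) (symApp h (Function.update (fun j => (es j).weaken) i (.bvar 0)))) := by
  cases h with
  | inl c => exact (LetRedex.letInCon c es i hi).letStep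
  | inr f => exact (LetRedex.letInFn f es i hi).letStep

theorem rename_symApp {n m : ℕ} (ρ : Fin n → Fin m) (h : S.CS ⊕ S.FS)
    (es : Fin (symArity h) → LExp S V n) :
    (symApp h es).rename ρ = symApp h (fun i => (es i).rename ρ) := by
  cases h <;> rfl

theorem inst_symApp {n : ℕ} (t : LExp S V n) (h : S.CS ⊕ S.FS)
    (es : Fin (symArity h) → LExp S V (n + 1)) :
    (symApp h es).inst t = symApp h (fun i => (es i).inst t) := by
  cases h <;> rfl

/-- The c-terms above `t`. -/
def CTermAbove (t : LExp S V 0) (n : ℕ) (e : LExp S V n) : Prop := e.IsCTerm ∧ Below t e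

/-- The expressions above `t`. -/
def ExpAbove (t : LExp S V 0) (n : ℕ) (e : LExp S V n) : Prop := e.IsExp ∧ Below t e

/-- The c-terms above `t` and, if `t` is `⊥`, also the function applications. -/
def ArgAbove (t : LExp S V 0) (n : ℕ) (e : LExp S V n) : Prop :=
  CTermAbove t n e ∨ t = .bot ∧ ∃ f es, e = .fn f es

theorem CTermAbove.stable (t : LExp S V 0) : Stable (CTermAbove t) :=
  fun _ _ _ τ hτ h => ⟨h.1.subst isCTerm_fvar hτ, h.2.subst τ⟩

theorem ArgAbove.stable (t : LExp S V 0) : Stable (ArgAbove t) := by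
  rintro n m e τ hτ (h | ⟨ht, f, es, rfl⟩)
  · exact .inl (CTermAbove.stable t n m e τ hτ h)
  · exact .inr ⟨ht, f, _, rfl⟩

/-- (Flat) moves the lets of `b` outwards until its innermost body is reached. A c-term is then put
in place by (Bind); a call whose wanted value is `⊥` stays bound, and its variable is a c-term above
`⊥`. -/
theorem reach_letIn_symApp {h : S.CS ⊕ S.FS}
    {K : Fin (symArity h) → (n : ℕ) → LExp S V n → Prop} (hK : ∀ j, Stable (K j))
    (i : Fin (symArity h)) {t : LExp S V 0} {n : ℕ} {b : LExp S V n}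
    (hb : Telescope (ArgAbove t) b) {es : Fin (symArity h) → LExp S V (n + 1)}
    (hi : es i = .bvar 0) (hes : ∀ j, j ≠ i → K j _ (es j)) :
    Reach P (fun n u => ∃ us, u = symApp h us ∧ CTermAbove t n (us i) ∧ ∀ j, j ≠ i → K j n (us j))
      (.letIn b (symApp h es)) := by
  induction hb with
  | base b hb =>
    rcases hb with hb | ⟨rfl, f, bs, rfl⟩
    · refine .step _ _ (LetRedex.bind b _ hb.1).letStep (.base _ ?_)
      refine ⟨_, inst_symApp b h es, ?_, fun j hj => (hK j).inst hb.1 (hes j hj)⟩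
      rw [hi]
      exact hb
    · exact .letIn _ _ (.base _ ⟨es, rfl, by rw [hi]; exact ⟨isCTerm_bvar 0, .bot _⟩, hes⟩)
  | letIn a b _ ih =>
    refine .step _ _ (LetRedex.flat a b _).letStep (.letIn _ _ ?_)
    rw [rename_symApp]
    refine ih ?_ fun j hj => (hK j).rename _ (hes j hj)
    rw [hi]
    rfl

theorem reach_symApp_arg {h : S.CS ⊕ S.FS}
    {K : Fin (symArity h) → (n : ℕ) → LExp S V n → Prop} (hK : ∀ j, Stable (K j))
    (i : Fin (symArity h)) {t : LExp S V 0} {n : ℕ} {es : Fin (symArity h) → LExp S V n}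
    (hi : Telescope (ArgAbove t) (es i)) (hes : ∀ j, j ≠ i → K j _ (es j)) :
    Reach P (fun n u => ∃ us, u = symApp h us ∧ CTermAbove t n (us i) ∧ ∀ j, j ≠ i → K j n (us j))
      (symApp h es) := by
  by_cases hc : CTermAbove t n (es i)
  · exact .base _ ⟨es, rfl, hc, hes⟩
  · have hfl : (es i).IsFnOrLet := by
      generalize es i = e at hi hc
      cases hi with
      | base e h =>
        rcases h with h | ⟨-, f, es, rfl⟩
        exacts [(hc h).elim, trivial]
      | letIn => trivial
    refine .step _ _ (letStep_letIn h es i hfl) ?_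
    refine reach_letIn_symApp hK i hi (Function.update_self _ _ _) fun j hj => ?_
    rw [Function.update_of_ne hj]
    exact (hK j).rename _ (hes j hj)

/-- All arguments are first rewritten in place to telescopes, then hoisted one by one; `s` collects
those already turned into c-terms. The others end up under the new lets, which is why stability is
needed. -/
theorem reach_symApp {h : S.CS ⊕ S.FS} {n : ℕ} {es : Fin (symArity h) → LExp S V n}
    {ts : Fin (symArity h) → LExp S V 0} (hes : ∀ i, Reach P (ArgAbove (ts i)) (es i)) :
    Reach P (fun n u => ∃ us, u = symApp h us ∧ ∀ i, CTermAbove (ts i) n (us i))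
      (symApp h es) := by
  choose es' h1 h2 using fun i => (hes i).exists_telescope
  refine .of_letSteps (reflTransGen_pi (symApp h) (LetStep.symApp h) h1) ?_
  have key : ∀ s : Finset (Fin (symArity h)), Reach P (fun n u => ∃ us, u = symApp h us ∧
      ∀ i, (i ∈ s → CTermAbove (ts i) n (us i)) ∧ (i ∉ s → Telescope (ArgAbove (ts i)) (us i)))
      (symApp h es') := by
    intro s
    induction s using Finset.induction_on with
    | empty => exact .base _ ⟨es', rfl, fun i => ⟨by simp, fun _ => h2 i⟩⟩
    | insert i s his ih =>
      refine ih.bind ?_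
      rintro n _ ⟨us, rfl, hus⟩
      have hK : ∀ j, Stable (fun n (u : LExp S V n) => (j ∈ s → CTermAbove (ts j) n u) ∧
          (j ∉ s → Telescope (ArgAbove (ts j)) u)) := fun j n m e τ hτ h =>
        ⟨fun hj => CTermAbove.stable _ n m e τ hτ (h.1 hj),
          fun hj => Telescope.stable (ArgAbove.stable _) n m e τ hτ (h.2 hj)⟩
      refine (reach_symApp_arg hK i ((hus i).2 his) fun j _ => hus j).bind ?_
      rintro n _ ⟨vs, rfl, hi, hvs⟩
      refine .base _ ⟨vs, rfl, fun j => ?_⟩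
      by_cases hj : j = i
      · subst hj
        exact ⟨fun _ => hi, fun hj => (hj (Finset.mem_insert_self _ _)).elim⟩
      · have := hvs j hj
        exact ⟨fun hm => this.1 ((Finset.mem_insert.1 hm).resolve_left hj),
          fun hm => this.2 fun hm' => hm (Finset.mem_insert_of_mem hm')⟩
  refine (key Finset.univ).bind ?_
  rintro n _ ⟨us, rfl, hus⟩
  exact .base _ ⟨us, rfl, fun i => (hus i).1 (Finset.mem_univ i)⟩

/-- The calls left in `u` lie over `⊥`s of `t`. Those under constructors are let-bound, so that a
c-term remains; no program rule is needed. -/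
theorem reach_argAbove {n : ℕ} {u : LExp S V n} (hu : u.IsExp) {t : LExp S V 0}
    (ht : t.IsPCTerm) (h : Below t u) : Reach P (ArgAbove t) u := by
  induction u generalizing t with
  | fvar x => exact .base _ (.inl ⟨isCTerm_fvar x, h⟩)
  | bvar i => exact .base _ (.inl ⟨isCTerm_bvar i, h⟩)
  | bot => exact hu.2.elim
  | con c es ih =>
    -- Even if `t` is `⊥`, the arguments must become c-terms; the value asked of each is then `⊥`.
    obtain ⟨ts, hts, hle⟩ : ∃ ts : Fin (S.arC c) → LExp S V 0,
        (∀ i, (ts i).IsPCTerm ∧ Below (ts i) (es i)) ∧ (t = .bot ∨ t = .con c ts) := by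
      cases h with
      | bot => exact ⟨fun _ => .bot, fun i => ⟨isPCTerm_bot, .bot _⟩, .inl rfl⟩
      | con _ ts _ h => exact ⟨ts, fun i => ⟨isPCTerm_con.1 ht i, h i⟩, .inr rfl⟩
    refine (reach_symApp (h := .inl c) (ts := ts)
      fun i => ih i (isExp_con.1 hu i) (hts i).1 (hts i).2).bind ?_
    rintro n _ ⟨us, rfl, hus⟩
    refine .base _ (.inl ⟨isCTerm_con.2 fun i => (hus i).1, ?_⟩)
    rcases hle with rfl | rfl
    · exact .bot _
    · exact .con _ _ _ fun i => (hus i).2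
  | fn f es =>
    cases h with
    | bot => exact .base _ (.inr ⟨rfl, f, es, rfl⟩)
    | fn => exact ht.2.elim
  | letIn a b => exact hu.1.elim

/-! ### CRWL-values are reached by let-rewriting -/

/-- Once all arguments are c-terms, matching yields a total c-substitution, as (Fapp) demands. The
depth `n` is arbitrary because lets accumulate during the evaluation. -/
theorem CRWL.reach [Nonempty V] {e t : LExp S V 0} (h : CRWL P e t) {n : ℕ}
    {e₁ : LExp S V n} (he : Below e e₁) (he₁ : e₁.IsExp) : Reach P (ExpAbove t) e₁ := by
  induction h generalizing n e₁ with
  | B => exact .base _ ⟨he₁, .bot _⟩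
  | RR x => exact .base _ ⟨he₁, he⟩
  | DC c es ts hts ih =>
    cases he with | con _ _ es₁ hes =>
    refine (reach_symApp (h := .inl c) (ts := ts) fun i =>
      (ih i (hes i) (isExp_con.1 he₁ i)).bind fun n u hu =>
        reach_argAbove hu.1 (hts i).isPCTerm hu.2).bind ?_
    rintro n _ ⟨us, rfl, hus⟩
    exact .base _ ⟨isExp_con.2 fun i => (hus i).1.isExp, .con _ _ _ fun i => (hus i).2⟩
  | OR f ps r θ es t hR hθ hargs _ ih ihr =>
    cases he with | fn _ _ es₁ hes =>
    refine (reach_symApp (h := .inr f) (ts := fun i => (ps i).app θ) fun i =>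
      (ih i (hes i) (isExp_fn.1 he₁ i)).bind fun n u hu =>
        reach_argAbove hu.1 (hargs i).isPCTerm hu.2).bind ?_
    rintro n _ ⟨us, rfl, hus⟩
    have hrule := P.isProgramRule _ hR
    obtain ⟨σ, rfl, hσ, hB, hextra⟩ := exists_match_rule (Q := IsCTerm)
      (fun c es h => isCTerm_con.1 h) (fun e h => h) hrule hθ (fun i => (hus i).1)
      (fun i => (hus i).2)
    have hr := hrule.2.2
    refine .step _ _ (LetRedex.fapp f ps r σ hR ⟨hσ, fun x => (hB x).2⟩ hextra).letStep ?_
    exact ihr (hr.1.below_app fun x => (hB x).1) (hr.app fun x => (hB x).2.isExp)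

theorem Telescope.below_shell {t : LExp S V 0} (ht : t.IsPCTerm) {n : ℕ} {e : LExp S V n}
    (h : Telescope (ExpAbove t) e) : Below t e.shell := by
  induction h with
  | base e h => exact h.2.shell ht
  | letIn a b _ ih => exact ih.subst _

/-- The innermost body is a copy of the total `t`, which mentions no let-bound variable, so (Elim)
removes the lets from the inside out. -/
theorem Telescope.letSteps_fill (v : V) {t : LExp S V 0} (ht : t.NoBot) {n : ℕ} {e : LExp S V n}
    (h : Telescope (ExpAbove t) e) : LetSteps P e (fill v t) := by
  induction h with
  | base e h => rw [h.2.eq_fill v ht]; exact .refl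
  | letIn a b _ ih =>
    refine (ih.letBody a).tail ?_
    rw [← weaken_fill v t]
    exact (LetRedex.elim a _).letStep

theorem LetRedex.noBot {n : ℕ} {e e' : LExp S V n} (h : LetRedex P e e') (he : e.NoBot) :
    e'.NoBot := by
  have hupd : ∀ (k : ℕ) (es : Fin k → LExp S V n) (i j : Fin k), (∀ j, (es j).NoBot) →
      (Function.update (fun j => (es j).weaken) i (.bvar 0) j).NoBot := fun k es i j h => by
    by_cases hj : j = i
    · subst hj
      rw [Function.update_self]
      trivial
    · rw [Function.update_of_ne hj]
      exact noBot_rename.2 (h j)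
  cases h with
  | fapp f ps r θ hR hθ _ =>
    exact ((P.isProgramRule _ hR).2.2.app fun x => (hθ.2 x).isExp).2
  | letInCon c es i _ => exact ⟨he i, fun j => hupd _ es i j he⟩
  | letInFn f es i _ => exact ⟨he i, fun j => hupd _ es i j he⟩
  | bind t b ht =>
    exact he.2.subst (fun x => trivial) fun i => Fin.cases he.1 (fun j => trivial) i
  | elim a b => exact noBot_rename.1 he.2
  | flat e₁ e₂ e₃ => exact ⟨he.1.1, he.1.2, noBot_rename.2 he.2⟩

theorem LetSteps.noBot {n : ℕ} {e e' : LExp S V n} (h : LetSteps P e e') (he : e.NoBot) :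
    e'.NoBot := by
  induction h with
  | refl => exact he
  | tail _ h ih =>
    obtain ⟨m, C, a, a', hr, rfl, rfl⟩ := h
    exact C.noBot_plug hr.noBot ih

theorem CRWL.exists_letSteps [Nonempty V] {e t : LExp S V 0} (h : CRWL P e t) (he : e.IsExp) :
    ∃ e', e'.IsLExp ∧ LetSteps P e e' ∧ Approx t e'.shell := by
  obtain ⟨e', h1, h2⟩ := (h.reach he.1.below_refl he).exists_telescope
  exact ⟨e', h1.noBot he.2, h1, (h2.below_shell h.isPCTerm).approx⟩

theorem CRWL.letSteps [Nonempty V] {e t : LExp S V 0} (h : CRWL P e t) (he : e.IsExp)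
    (ht : t.IsCTerm) : LetSteps P e t := by
  obtain ⟨v⟩ := id ‹Nonempty V›
  obtain ⟨e', h1, h2⟩ := (h.reach he.1.below_refl he).exists_telescope
  have := h1.trans (h2.letSteps_fill v ht.2.2)
  rwa [fill_self v ht.isExp] at this

end Completeness

theorem mainTheorem8 {S : Signature} {V : Type*} [Countable V] [Infinite V] (P : Program S V)
    (hP : P.IsCRWLDeterministic) :
    (∀ e e' : LExp S V 0, e.IsExp → e'.IsExp → RwSteps P e e' →
      ∃ e'' : LExp S V 0, e''.IsLExp ∧ LetSteps P e e'' ∧ LExp.Approx e'.shell e''.shell) ∧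
    (∀ e t : LExp S V 0, e.IsExp → t.IsCTerm →
      (RwSteps P e t ↔ LetSteps P e t) ∧ (LetSteps P e t ↔ CRWL P e t)) ∧
    (∀ e e' : LExp S V 0, e.IsExp → e'.IsExp → RwSteps P e e' → den P e' ⊆ den P e) := by
  refine ⟨fun e e' he he' h => ?_, fun e t he ht => ?_, fun e e' _ _ h t ht =>
    ⟨ht.1, CRWL.of_rwSteps hP h ht.2⟩⟩
  -- The shell of `e'` is one of its values, hence also a value of `e`.
  · exact (CRWL.of_rwSteps hP h (CRWL.shell he'.1)).exists_letSteps he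
  · have hlet : LetSteps P e t ↔ CRWL P e t :=
      ⟨fun h => h.crwl he.1 ht.isPCTerm, fun h => h.letSteps he ht⟩
    refine ⟨⟨fun h => ?_, fun h => (hlet.1 h).rwSteps he ht⟩, hlet⟩
    exact hlet.2 (CRWL.of_rwSteps hP h (CRWL.refl ht.isPCTerm))
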